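/- Let $n\ge 0$ and let $\mathcal C$ be the class of convex, strictly increasing functions $\varphi:[0,\infty)\to[0,\infty)$ with $\varphi(0)=0$ and $\varphi(1)=1$. For $\varphi\in\mathcal C$ and a finite multiset $\Lambda$ of vectors of $\mathbb R^n$, let $Z^+_\varphi\Lambda$ be the unique nonempty compact convex set whose support function is $$h_{Z^+_\varphi\Lambda}(u)=\inf\Big\{\lambda>0:\ \sum_{w\in\Lambda}\varphi\Big(\frac{\max\{0,\langle w,u\rangle\}}{\lambda}\Big)\le 1\Big\},\qquad u\in\mathbb R^n,$$ where the sum is taken with multiplicities, and let $Z^+_1\Lambda$ be this set for $\varphi(t)=t$. Let $V$ denote $n$-dimensional volume and let $\Lambda_\bot=\{e_1,\dots,e_n\}$ be the canonical basis of $\mathbb R^n$. A set of vectors is called obtuse if $\max\{0,\langle u,v\rangle\}=0$ for any two distinct elements $u,v$ of it. **Theorem.** Let $\varphi\in\mathcal C$ and let $\Lambda$ be a finite multiset of vectors that spans $\mathbb R^n$. Then $$\frac{V(Z^+_\varphi\Lambda)}{V(Z^+_1\Lambda)}\le\frac{V(Z^+_\varphi\Lambda_\bot)}{V(Z^+_1\Lambda_\bot)}.$$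 If $\varphi$ is not the identity on $[0,1]$, then equality holds if and only if the multiset of nonzero elements of $\Lambda$ is the image of an obtuse set under an element of $GL(n)$ (in particular, every nonzero element of $\Lambda$ has multiplicity one). If $\varphi(t)=t$ for all $t\in[0,1]$, then equality always holds. -/

import Mathlib

open MeasureTheory

noncomputable section

/-- The class `𝒞` of convex, strictly increasing functions `φ : [0, ∞) → [0, ∞)` with `φ 0 = 0`
and `φ 1 = 1`. Such a function is represented by a function on `ℝ` of which only the values on
`[0, ∞)` are ever used; that these are nonnegative follows from `zero` and `strictMono`. -/
structure OrliczClass (φ : ℝ → ℝ) : Prop where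
  convex : ConvexOn ℝ (Set.Ici 0) φ
  strictMono : StrictMonoOn φ (Set.Ici 0)
  zero : φ 0 = 0
  one : φ 1 = 1

/-- A finite multiset of vectors is spanning if its elements span the whole space. -/
def IsSpanning {n : ℕ} (Λ : Multiset (EuclideanSpace ℝ (Fin n))) : Prop :=
  Submodule.span ℝ {v | v ∈ Λ} = ⊤

/-- The function `u ↦ inf {r > 0 : ∑_{w ∈ Λ} φ (⟨w, u⟩₊ / r) ≤ 1}`, the sum being taken with
multiplicities. It is `0` if `⟨w, u⟩₊ = 0` for all `w ∈ Λ`. -/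
def orliczSupport {n : ℕ} (φ : ℝ → ℝ) (Λ : Multiset (EuclideanSpace ℝ (Fin n)))
    (u : EuclideanSpace ℝ (Fin n)) : ℝ :=
  sInf {r : ℝ | 0 < r ∧ (Λ.map fun w => φ (max 0 (inner ℝ w u) / r)).sum ≤ 1}

/-- The asymmetric Orlicz zonotope `Z⁺_φ Λ`: the compact convex set with support function
`orliczSupport φ Λ` (see `orliczZonotope_unique` below). -/
def orliczZonotope {n : ℕ} (φ : ℝ → ℝ) (Λ : Multiset (EuclideanSpace ℝ (Fin n))) :
    Set (EuclideanSpace ℝ (Fin n)) :=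
  {x | ∀ u, inner ℝ x u ≤ orliczSupport φ Λ u}

/-- The volume ratio `V(Z⁺_φ Λ) / V(Z⁺_1 Λ)`, where `Z⁺_1` belongs to the identity function. -/
def volumeRatio {n : ℕ} (φ : ℝ → ℝ) (Λ : Multiset (EuclideanSpace ℝ (Fin n))) : ℝ :=
  volume.real (orliczZonotope φ Λ) / volume.real (orliczZonotope (fun t => t) Λ)

/-- The canonical basis `Λ_⊥ = {e₁, …, eₙ}` as a multiset. -/
def canonicalBasis (n : ℕ) : Multiset (EuclideanSpace ℝ (Fin n)) :=
  Finset.univ.val.map fun i : Fin n => EuclideanSpace.single i (1 : ℝ)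

/-- A set of vectors is obtuse if `⟨u, v⟩₊ = 0` for any two distinct elements `u`, `v`. -/
def IsObtuse {n : ℕ} (S : Set (EuclideanSpace ℝ (Fin n))) : Prop :=
  ∀ u ∈ S, ∀ v ∈ S, u ≠ v → max 0 (inner ℝ u v) = 0

/-- `Λ` is the image of an obtuse set under an element of `GL(n)`. Since the obtuse set is a set,
every element of such a multiset `Λ` has multiplicity one. -/
def IsGLImageOfObtuse {n : ℕ} (Λ : Multiset (EuclideanSpace ℝ (Fin n))) : Prop :=
  ∃ (S : Finset (EuclideanSpace ℝ (Fin n)))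
    (g : EuclideanSpace ℝ (Fin n) ≃ₗ[ℝ] EuclideanSpace ℝ (Fin n)),
    IsObtuse (S : Set (EuclideanSpace ℝ (Fin n))) ∧ Λ = S.val.map g

open Classical in
/-- The multiset obtained from `Λ` by deleting all copies of the zero vector. -/
def nonzeroPart {n : ℕ} (Λ : Multiset (EuclideanSpace ℝ (Fin n))) :
    Multiset (EuclideanSpace ℝ (Fin n)) :=
  Λ.filter fun v => v ≠ 0

/- The lemmas below check that `orliczZonotope φ Λ` is indeed the unique nonempty compact
convex set with support function `orliczSupport φ Λ`. -/

theorem orlicz_feasible_nonempty {n : ℕ} {φ : ℝ → ℝ} (hφ : OrliczClass φ)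
    (Λ : Multiset (EuclideanSpace ℝ (Fin n))) (u : EuclideanSpace ℝ (Fin n)) :
    {r : ℝ | 0 < r ∧ (Λ.map fun w => φ (max 0 (inner ℝ w u) / r)).sum ≤ 1}.Nonempty := by
  set s : ℝ := (Λ.map fun w => max 0 (inner ℝ w u)).sum with hs
  have hs0 : 0 ≤ s := Multiset.sum_nonneg (by simp +contextual)
  refine ⟨s + 1, by linarith, ?_⟩
  have hle : ∀ w ∈ Λ, φ (max 0 (inner ℝ w u) / (s + 1)) ≤ max 0 (inner ℝ w u) / (s + 1) := by
    intro w hw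
    have h1 : max 0 (inner ℝ w u) ≤ s :=
      Multiset.single_le_sum (s := Λ.map fun w => max 0 (inner ℝ w u)) (by simp +contextual) _
        (Multiset.mem_map_of_mem _ hw)
    set t := max 0 (inner ℝ w u) / (s + 1) with ht
    have ht0 : 0 ≤ t := by positivity
    have ht1 : t ≤ 1 := by
      rw [ht, div_le_one (by linarith)]; linarith
    have := hφ.convex.2 (Set.mem_Ici.2 (zero_le_one (α := ℝ)))
      (Set.mem_Ici.2 (le_refl (0 : ℝ))) ht0 (sub_nonneg.2 ht1) (by ring)
    simpa [hφ.zero, hφ.one] using this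
  refine (Multiset.sum_map_le_sum_map _ _ hle).trans ?_
  rw [Multiset.sum_map_div, ← hs, div_le_one (by linarith)]
  linarith

theorem orlicz_feasible_bddBelow {n : ℕ} (φ : ℝ → ℝ)
    (Λ : Multiset (EuclideanSpace ℝ (Fin n))) (u : EuclideanSpace ℝ (Fin n)) :
    BddBelow {r : ℝ | 0 < r ∧ (Λ.map fun w => φ (max 0 (inner ℝ w u) / r)).sum ≤ 1} :=
  ⟨0, fun _ h => h.1.le⟩

theorem orliczSupport_add_le {n : ℕ} {φ : ℝ → ℝ} (hφ : OrliczClass φ)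
    (Λ : Multiset (EuclideanSpace ℝ (Fin n))) (u v : EuclideanSpace ℝ (Fin n)) :
    orliczSupport φ Λ (u + v) ≤ orliczSupport φ Λ u + orliczSupport φ Λ v := by
  have key : ∀ r ∈ {r : ℝ | 0 < r ∧ (Λ.map fun w => φ (max 0 (inner ℝ w u) / r)).sum ≤ 1},
      ∀ s ∈ {r : ℝ | 0 < r ∧ (Λ.map fun w => φ (max 0 (inner ℝ w v) / r)).sum ≤ 1},
      orliczSupport φ Λ (u + v) ≤ r + s := by
    rintro r ⟨hr, hr1⟩ s ⟨hs, hs1⟩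
    refine csInf_le (orlicz_feasible_bddBelow φ Λ (u + v)) ⟨add_pos hr hs, ?_⟩
    have hle : ∀ w ∈ Λ, φ (max 0 (inner ℝ w (u + v)) / (r + s)) ≤
        r / (r + s) * φ (max 0 (inner ℝ w u) / r) + s / (r + s) * φ (max 0 (inner ℝ w v) / s) := by
      intro w _
      have hxu : max 0 (inner ℝ w u) / r ∈ Set.Ici (0 : ℝ) := Set.mem_Ici.2 (by positivity)
      have hxv : max 0 (inner ℝ w v) / s ∈ Set.Ici (0 : ℝ) := Set.mem_Ici.2 (by positivity)
      have ha : 0 ≤ r / (r + s) := by positivity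
      have hb : 0 ≤ s / (r + s) := by positivity
      have h1 := hφ.convex.2 hxu hxv ha hb (by field_simp)
      refine le_trans (hφ.strictMono.monotoneOn (Set.mem_Ici.2 (by positivity))
        (Set.mem_Ici.2 (by simp only [smul_eq_mul]; positivity)) ?_) h1
      have h2 : max 0 (inner ℝ w (u + v)) ≤ max 0 (inner ℝ w u) + max 0 (inner ℝ w v) := by
        rw [inner_add_right]
        exact max_le (by positivity) (add_le_add (le_max_right _ _) (le_max_right _ _))
      have h3 : (r / (r + s)) • (max 0 (inner ℝ w u) / r) + (s / (r + s)) • (max 0 (inner ℝ w v) / s)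
          = (max 0 (inner ℝ w u) + max 0 (inner ℝ w v)) / (r + s) := by
        simp only [smul_eq_mul]; field_simp
      rw [h3]
      gcongr
    refine (Multiset.sum_map_le_sum_map _ _ hle).trans ?_
    rw [Multiset.sum_map_add, Multiset.sum_map_mul_left, Multiset.sum_map_mul_left]
    calc _ ≤ r / (r + s) * 1 + s / (r + s) * 1 := by gcongr
      _ = 1 := by field_simp
  have h1 : ∀ s ∈ {r : ℝ | 0 < r ∧ (Λ.map fun w => φ (max 0 (inner ℝ w v) / r)).sum ≤ 1},
      orliczSupport φ Λ (u + v) - s ≤ orliczSupport φ Λ u := fun s hs =>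
    le_csInf (orlicz_feasible_nonempty hφ Λ u) fun r hr => by linarith [key r hr s hs]
  have h2 : orliczSupport φ Λ (u + v) - orliczSupport φ Λ u ≤ orliczSupport φ Λ v :=
    le_csInf (orlicz_feasible_nonempty hφ Λ v) fun s hs => by linarith [h1 s hs]
  linarith

theorem orliczSupport_smul_le {n : ℕ} {φ : ℝ → ℝ} (hφ : OrliczClass φ)
    (Λ : Multiset (EuclideanSpace ℝ (Fin n))) {c : ℝ} (hc : 0 < c)
    (u : EuclideanSpace ℝ (Fin n)) :
    orliczSupport φ Λ (c • u) ≤ c * orliczSupport φ Λ u := by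
  have h : c⁻¹ * orliczSupport φ Λ (c • u) ≤ orliczSupport φ Λ u := by
    refine le_csInf (orlicz_feasible_nonempty hφ Λ u) ?_
    rintro r ⟨hr, hr1⟩
    rw [inv_mul_le_iff₀ hc]
    refine csInf_le (orlicz_feasible_bddBelow φ Λ (c • u)) ⟨by positivity, ?_⟩
    have hw : ∀ w : EuclideanSpace ℝ (Fin n),
        max 0 (inner ℝ w (c • u)) / (c * r) = max 0 (inner ℝ w u) / r := fun w => by
      rw [inner_smul_right, ← mul_div_mul_left _ r hc.ne', mul_max_of_nonneg _ _ hc.le, mul_zero]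
    simpa only [hw] using hr1
  rwa [inv_mul_le_iff₀ hc] at h

theorem orliczSupport_smul {n : ℕ} {φ : ℝ → ℝ} (hφ : OrliczClass φ)
    (Λ : Multiset (EuclideanSpace ℝ (Fin n))) {c : ℝ} (hc : 0 < c)
    (u : EuclideanSpace ℝ (Fin n)) :
    orliczSupport φ Λ (c • u) = c * orliczSupport φ Λ u := by
  refine le_antisymm (orliczSupport_smul_le hφ Λ hc u) ?_
  have := orliczSupport_smul_le hφ Λ (inv_pos.2 hc) (c • u)
  rw [inv_smul_smul₀ hc.ne'] at this
  rwa [le_inv_mul_iff₀ hc] at this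

theorem orliczSupport_nonneg {n : ℕ} {φ : ℝ → ℝ} (Λ : Multiset (EuclideanSpace ℝ (Fin n)))
    (u : EuclideanSpace ℝ (Fin n)) : 0 ≤ orliczSupport φ Λ u :=
  Real.sInf_nonneg fun _ h => h.1.le

theorem convex_orliczZonotope {n : ℕ} (φ : ℝ → ℝ) (Λ : Multiset (EuclideanSpace ℝ (Fin n))) :
    Convex ℝ (orliczZonotope φ Λ) := by
  intro x hx y hy a b ha hb hab u
  rw [inner_add_left, real_inner_smul_left, real_inner_smul_left]
  calc _ ≤ a * orliczSupport φ Λ u + b * orliczSupport φ Λ u := by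
        gcongr
        · exact hx u
        · exact hy u
    _ = orliczSupport φ Λ u := by rw [← add_mul, hab, one_mul]

theorem isCompact_orliczZonotope {n : ℕ} (φ : ℝ → ℝ)
    (Λ : Multiset (EuclideanSpace ℝ (Fin n))) : IsCompact (orliczZonotope φ Λ) := by
  have hclosed : IsClosed (orliczZonotope φ Λ) := by
    simp only [orliczZonotope, Set.ofPred_forall]
    exact isClosed_iInter fun u => isClosed_le (by fun_prop) continuous_const
  refine Metric.isCompact_of_isClosed_isBounded hclosed ?_
  refine (Metric.isBounded_iff_subset_closedBall 0).2
    ⟨∑ i : Fin n, (orliczSupport φ Λ (EuclideanSpace.single i 1) +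
      orliczSupport φ Λ (-EuclideanSpace.single i 1)), fun x hx => ?_⟩
  rw [mem_closedBall_zero_iff]
  have hx' : x = ∑ i : Fin n, x i • EuclideanSpace.single i (1 : ℝ) := by
    ext j
    simp [Pi.single_apply]
  rw [hx']
  refine (norm_sum_le _ _).trans (Finset.sum_le_sum fun i _ => ?_)
  have h1 := hx (EuclideanSpace.single i 1)
  have h2 := hx (-EuclideanSpace.single i 1)
  have h3 := orliczSupport_nonneg (φ := φ) Λ (EuclideanSpace.single i 1)
  have h4 := orliczSupport_nonneg (φ := φ) Λ (-EuclideanSpace.single i 1)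
  simp only [inner_neg_right, EuclideanSpace.inner_single_right, one_mul,
    conj_trivial] at h1 h2
  rw [norm_smul, PiLp.norm_single, norm_one, mul_one, Real.norm_eq_abs, abs_le]
  constructor <;> linarith

theorem isGreatest_orliczSupport {n : ℕ} {φ : ℝ → ℝ} (hφ : OrliczClass φ)
    (Λ : Multiset (EuclideanSpace ℝ (Fin n))) (u : EuclideanSpace ℝ (Fin n)) :
    IsGreatest ((fun x => inner ℝ x u) '' orliczZonotope φ Λ) (orliczSupport φ Λ u) := by
  refine ⟨?_, by rintro _ ⟨x, hx, rfl⟩; exact hx u⟩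
  have h0 : orliczSupport φ Λ 0 = 0 := by
    have := orliczSupport_smul hφ Λ (c := 2) (by norm_num) 0
    rw [smul_zero] at this
    linarith
  have hker : ∀ c : ℝ, c • u = 0 → RingHom.id ℝ c • orliczSupport φ Λ u = 0 := by
    intro c hc
    rcases smul_eq_zero.1 hc with h | h
    · simp [h]
    · simp [h, h0]
  obtain ⟨g, hg1, hg2⟩ := exists_extension_of_le_sublinear
    (LinearPMap.mkSpanSingleton' (σ := RingHom.id ℝ) u (orliczSupport φ Λ u) hker)
    (orliczSupport φ Λ)
    (fun c hc x => orliczSupport_smul hφ Λ hc x) (orliczSupport_add_le hφ Λ) (by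
      rintro ⟨x, hx⟩
      obtain ⟨c, rfl⟩ := Submodule.mem_span_singleton.1 hx
      rw [LinearPMap.mkSpanSingleton'_apply]
      simp only [RingHom.id_apply, smul_eq_mul]
      rcases lt_trichotomy c 0 with hc | hc | hc
      · have h1 := orliczSupport_nonneg (φ := φ) Λ u
        have h2 := orliczSupport_nonneg (φ := φ) Λ (c • u)
        nlinarith
      · simp [hc, h0]
      · exact (orliczSupport_smul hφ Λ hc u).ge)
  have hgu : g u = orliczSupport φ Λ u := by
    have hu : u ∈ (LinearPMap.mkSpanSingleton' (σ := RingHom.id ℝ) u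
        (orliczSupport φ Λ u) hker).domain := Submodule.mem_span_singleton_self u
    rw [hg1 ⟨u, hu⟩]
    exact (LinearPMap.mkSpanSingleton'_apply_self u _ hker hu)
  let x := (InnerProductSpace.toDual ℝ (EuclideanSpace ℝ (Fin n))).symm
    (LinearMap.toContinuousLinearMap g)
  have hx : ∀ v, inner ℝ x v = g v := fun v => by simp [x]
  exact ⟨x, fun v => by rw [hx]; exact hg2 v, by simp only [hx, hgu]⟩

theorem orliczZonotope_unique {n : ℕ} {φ : ℝ → ℝ} (hφ : OrliczClass φ)
    (Λ : Multiset (EuclideanSpace ℝ (Fin n))) (K : Set (EuclideanSpace ℝ (Fin n))) :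
    (IsCompact K ∧ Convex ℝ K ∧
      ∀ u, IsGreatest ((fun x => inner ℝ x u) '' K) (orliczSupport φ Λ u)) ↔
    K = orliczZonotope φ Λ := by
  refine ⟨?_, ?_⟩
  · rintro ⟨hK, hKc, hKs⟩
    refine Set.Subset.antisymm (fun x hx u => (hKs u).2 ⟨x, hx, rfl⟩) fun x hx => ?_
    by_contra hxK
    obtain ⟨f, s, hf, hs⟩ := geometric_hahn_banach_closed_point hKc hK.isClosed hxK
    obtain ⟨y, hy, hys⟩ := (hKs ((InnerProductSpace.toDual ℝ _).symm f)).1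
    have h1 := hx ((InnerProductSpace.toDual ℝ _).symm f)
    have h2 := hf y hy
    simp only at hys
    rw [← hys, real_inner_comm, real_inner_comm _ y, InnerProductSpace.toDual_symm_apply,
      InnerProductSpace.toDual_symm_apply] at h1
    linarith
  · rintro rfl
    exact ⟨isCompact_orliczZonotope φ Λ, convex_orliczZonotope φ Λ, isGreatest_orliczSupport hφ Λ⟩

end

/-! The proof is a deletion–contraction argument. Let P be the orthogonal projection along a nonzero
w. Slicing by lines parallel to w, each fibre of Z⁺_φ(w, Λ) lies in the sum of the corresponding
fibres of Z⁺_φ Λ and Z⁺_φ(w, PΛ), and lengths of intervals add. Hence V(w, Λ) ≤ V(Λ) + V(w, PΛ)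
(`volume_orliczZonotope_cons_le`), with equality for the identity function, whose coefficient body
is a cube (`volume_zonotope_cons`). So `volumeDeficit`, the bound minus the volume, satisfies D(w,
Λ) ≥ D(Λ) + D(w, PΛ). Repeating this leaves orthogonal families of nonzero vectors. Their deficit
vanishes, since they are either not spanning or linear images of the canonical basis. Thus D ≥ 0,
which is the inequality.

For obtuse families the volume recursion is an equality for every φ
(`volume_orliczZonotope_cons_of_obtuse`) and projection preserves obtuseness, so D = 0; linear maps
only scale D.

Conversely, suppose two members u, v of Λ lie strictly on the same side of a hyperplane spanned by
members of Λ. Deleting everything else off the hyperplane and contracting everything in it does not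
increase D and turns u, v into positive multiples of the normal. Merging these two parallel vectors
keeps the classical zonotope but strictly enlarges the Orlicz one when φ is not the identity on [0,
1], so D > 0 (`volumeDeficit_pos_of_spansHyperplane`). If no such pair exists, the coordinates with
respect to n independent normals of this kind map the nonzero part of Λ to an obtuse set
(`isGLImageOfObtuse_nonzeroPart`). -/

/-! ### Convexity estimates for Orlicz functions -/

theorem orliczClass_id : OrliczClass fun t => t where
  convex := convexOn_id (convex_Ici 0)
  strictMono := strictMono_id.strictMonoOn _
  zero := rfl
  one := rfl

namespace OrliczClass

variable {φ : ℝ → ℝ}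

theorem nonneg (hφ : OrliczClass φ) {t : ℝ} (ht : 0 ≤ t) : 0 ≤ φ t := by
  rw [← hφ.zero]
  exact hφ.strictMono.monotoneOn Set.self_mem_Ici ht ht

theorem map_mul_le (hφ : OrliczClass φ) {a t : ℝ} (ha : 0 ≤ a) (ha1 : a ≤ 1) (ht : 0 ≤ t) :
    φ (a * t) ≤ a * φ t := by
  have := hφ.convex.2 (Set.mem_Ici.2 ht) Set.self_mem_Ici ha (sub_nonneg.2 ha1) (by ring)
  simpa [hφ.zero] using this

theorem le_self (hφ : OrliczClass φ) {t : ℝ} (ht : t ∈ Set.Icc (0 : ℝ) 1) : φ t ≤ t := by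
  simpa [hφ.one] using hφ.map_mul_le ht.1 ht.2 zero_le_one

/-- Both a and b are fractions of a + b, and the two fractions sum to 1. This makes merging parallel
generators enlarge the zonotope. -/
theorem superadditive (hφ : OrliczClass φ) {a b : ℝ} (ha : 0 ≤ a) (hb : 0 ≤ b) :
    φ a + φ b ≤ φ (a + b) := by
  rcases (add_nonneg ha hb).eq_or_lt with h | h
  · obtain rfl : a = 0 := by linarith
    obtain rfl : b = 0 := by linarith
    simp [hφ.zero]
  · have h1 := hφ.map_mul_le (a := a / (a + b)) (t := a + b) (by positivity)
      (by rw [div_le_one h]; linarith) h.le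
    have h2 := hφ.map_mul_le (a := b / (a + b)) (t := a + b) (by positivity)
      (by rw [div_le_one h]; linarith) h.le
    rw [div_mul_cancel₀ _ h.ne'] at h1 h2
    have : a / (a + b) * φ (a + b) + b / (a + b) * φ (a + b) = φ (a + b) := by field_simp
    linarith

/-- A function of the class that differs from the identity somewhere on `[0, 1]` lies strictly
below it on all of `(0, 1)`. -/
theorem lt_self (hφ : OrliczClass φ) (hne : ∃ t ∈ Set.Icc (0 : ℝ) 1, φ t ≠ t) {t : ℝ}
    (ht : t ∈ Set.Ioo (0 : ℝ) 1) : φ t < t := by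
  obtain ⟨s, hs, hsne⟩ := hne
  have hslt := (hφ.le_self hs).lt_of_ne hsne
  have hs0 : 0 < s := hs.1.lt_of_ne (by rintro rfl; exact hsne hφ.zero)
  have hs1 : s < 1 := hs.2.lt_of_ne (by rintro rfl; exact hsne hφ.one)
  -- t is a convex combination of 0 and s, or of s and 1; the strict gap at s carries over with
  -- positive weight.
  rcases le_total t s with h | h
  · have h1 := hφ.map_mul_le (a := t / s) (t := s) (by have := ht.1; positivity)
      ((div_le_one hs0).2 h) hs0.le
    rw [div_mul_cancel₀ _ hs0.ne'] at h1
    have h2 : t / s * φ s < t / s * s := by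
      have := ht.1
      gcongr
    rw [div_mul_cancel₀ _ hs0.ne'] at h2
    linarith
  · have h1s : 0 < 1 - s := by linarith
    have ha : 0 ≤ (1 - t) / (1 - s) := div_nonneg (by linarith [ht.2]) h1s.le
    have hb : 0 ≤ (t - s) / (1 - s) := div_nonneg (by linarith) h1s.le
    have h1 := hφ.convex.2 (Set.mem_Ici.2 hs0.le) (Set.mem_Ici.2 (zero_le_one (α := ℝ)))
      ha hb (by field_simp; ring)
    have h3 : (1 - t) / (1 - s) * s + (t - s) / (1 - s) * 1 = t := by field_simp; ring
    simp only [smul_eq_mul, hφ.one] at h1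
    rw [h3] at h1
    have h2 : (1 - t) / (1 - s) * φ s < (1 - t) / (1 - s) * s := by
      have : 0 < 1 - t := by linarith [ht.2]
      gcongr
    linarith

end OrliczClass

/-! ### Support functions, linear images and coefficient bodies -/

section Support

variable {n : ℕ} {φ : ℝ → ℝ}

theorem orliczZonotope_congr {ψ : ℝ → ℝ} {Λ Γ : Multiset (EuclideanSpace ℝ (Fin n))}
    (h : ∀ u, orliczSupport φ Λ u = orliczSupport ψ Γ u) :
    orliczZonotope φ Λ = orliczZonotope ψ Γ := by
  simp only [orliczZonotope, h]

theorem orliczZonotope_zero_cons (hφ : OrliczClass φ)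
    (Λ : Multiset (EuclideanSpace ℝ (Fin n))) :
    orliczZonotope φ (0 ::ₘ Λ) = orliczZonotope φ Λ :=
  orliczZonotope_congr fun u => by simp [orliczSupport, hφ.zero]

theorem orliczZonotope_nonzeroPart (hφ : OrliczClass φ)
    (Λ : Multiset (EuclideanSpace ℝ (Fin n))) :
    orliczZonotope φ (nonzeroPart Λ) = orliczZonotope φ Λ := by
  have (u : EuclideanSpace ℝ (Fin n)) (r : ℝ) :
      ((nonzeroPart Λ).map fun w => φ (max 0 (inner ℝ w u) / r)).sum =
        (Λ.map fun w => φ (max 0 (inner ℝ w u) / r)).sum := by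
    induction Λ using Multiset.induction with
    | empty => simp [nonzeroPart]
    | cons w Λ ih =>
      unfold nonzeroPart at ih ⊢
      by_cases hw : w = 0
      · simp [hw, hφ.zero, ih]
      · simp [hw, ih]
  exact orliczZonotope_congr fun u => by simp only [orliczSupport, this]

theorem orliczSupport_le {Λ : Multiset (EuclideanSpace ℝ (Fin n))}
    {u : EuclideanSpace ℝ (Fin n)} {r : ℝ} (hr : 0 < r)
    (h : (Λ.map fun w => φ (max 0 (inner ℝ w u) / r)).sum ≤ 1) : orliczSupport φ Λ u ≤ r :=
  csInf_le (orlicz_feasible_bddBelow φ Λ u) ⟨hr, h⟩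

theorem div_le_one_of_feasible (hφ : OrliczClass φ) {Λ : Multiset (EuclideanSpace ℝ (Fin n))}
    {u w : EuclideanSpace ℝ (Fin n)} {r : ℝ} (hr : 0 < r)
    (h : (Λ.map fun w => φ (max 0 (inner ℝ w u) / r)).sum ≤ 1) (hw : w ∈ Λ) :
    max 0 (inner ℝ w u) / r ≤ 1 := by
  rw [← hφ.strictMono.le_iff_le (Set.mem_Ici.2 (by positivity)) (Set.mem_Ici.2 zero_le_one),
    hφ.one]
  refine le_trans ?_ h
  refine Multiset.single_le_sum (s := Λ.map fun w => φ (max 0 (inner ℝ w u) / r)) ?_ _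
    (Multiset.mem_map_of_mem _ hw)
  intro x hx
  obtain ⟨v, -, rfl⟩ := Multiset.mem_map.1 hx
  exact hφ.nonneg (by positivity)

theorem inner_le_orliczSupport (hφ : OrliczClass φ) {Λ : Multiset (EuclideanSpace ℝ (Fin n))}
    {w : EuclideanSpace ℝ (Fin n)} (hw : w ∈ Λ) (u : EuclideanSpace ℝ (Fin n)) :
    inner ℝ w u ≤ orliczSupport φ Λ u := by
  refine le_csInf (orlicz_feasible_nonempty hφ Λ u) ?_
  rintro r ⟨hr, h⟩
  exact (le_max_right _ _).trans ((div_le_one hr).1 (div_le_one_of_feasible hφ hr h hw))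

/-- Feasibility of r forces every argument of φ into [0, 1], so values beyond 1 never matter. -/
theorem orliczZonotope_eq_of_eq_id (hφ : OrliczClass φ)
    (hid : ∀ t ∈ Set.Icc (0 : ℝ) 1, φ t = t) (Λ : Multiset (EuclideanSpace ℝ (Fin n))) :
    orliczZonotope φ Λ = orliczZonotope (fun t => t) Λ := by
  refine orliczZonotope_congr fun u => congrArg sInf (Set.ext fun r => and_congr_right fun hr => ?_)
  have key (h1 : ∀ w ∈ Λ, max 0 (inner ℝ w u) / r ≤ 1) :
      (Λ.map fun w => φ (max 0 (inner ℝ w u) / r)).sum =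
        (Λ.map fun w => max 0 (inner ℝ w u) / r).sum := by
    rw [Multiset.map_congr rfl fun w hw => hid _ ⟨by positivity, h1 w hw⟩]
  refine ⟨fun h => ?_, fun h => ?_⟩
  · rwa [← key fun w => div_le_one_of_feasible hφ hr h]
  · rwa [key fun w => div_le_one_of_feasible orliczClass_id hr h]

theorem subset_orliczZonotope (hφ : OrliczClass φ) {Λ : Multiset (EuclideanSpace ℝ (Fin n))}
    {w : EuclideanSpace ℝ (Fin n)} (hw : w ∈ Λ) : w ∈ orliczZonotope φ Λ :=
  inner_le_orliczSupport hφ hw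

theorem zero_mem_orliczZonotope (Λ : Multiset (EuclideanSpace ℝ (Fin n))) :
    0 ∈ orliczZonotope φ Λ := fun u => by
  simpa using orliczSupport_nonneg Λ u

theorem orliczSupport_eq_zero (hφ : OrliczClass φ) {Λ : Multiset (EuclideanSpace ℝ (Fin n))}
    {u : EuclideanSpace ℝ (Fin n)} (h : ∀ w ∈ Λ, inner ℝ w u ≤ 0) :
    orliczSupport φ Λ u = 0 := by
  refine le_antisymm (le_of_forall_pos_le_add fun ε hε => ?_) (orliczSupport_nonneg Λ u)
  rw [zero_add]
  refine orliczSupport_le hε ?_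
  rw [Multiset.map_congr rfl (g := fun _ => (0 : ℝ))
    fun w hw => by rw [max_eq_left (h w hw), zero_div, hφ.zero]]
  simp

theorem orliczSupport_id (Λ : Multiset (EuclideanSpace ℝ (Fin n)))
    (u : EuclideanSpace ℝ (Fin n)) :
    orliczSupport (fun t => t) Λ u = (Λ.map fun w => max 0 (inner ℝ w u)).sum := by
  set s := (Λ.map fun w => max 0 (inner ℝ w u)).sum with hs
  have hs0 : 0 ≤ s := Multiset.sum_nonneg (by simp +contextual)
  refine le_antisymm (le_of_forall_pos_le_add fun ε hε => ?_) ?_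
  · refine orliczSupport_le (by positivity) ?_
    rw [Multiset.sum_map_div, ← hs, div_le_one (by positivity)]
    linarith
  · refine le_csInf (orlicz_feasible_nonempty orliczClass_id Λ u) ?_
    rintro r ⟨hr, h⟩
    rwa [Multiset.sum_map_div, ← hs, div_le_one hr] at h

theorem orliczSupport_map {m : ℕ}
    (g : EuclideanSpace ℝ (Fin n) →ₗ[ℝ] EuclideanSpace ℝ (Fin m))
    (Λ : Multiset (EuclideanSpace ℝ (Fin n))) (u : EuclideanSpace ℝ (Fin m)) :
    orliczSupport φ (Λ.map g) u = orliczSupport φ Λ (LinearMap.adjoint g u) := by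
  simp [orliczSupport, LinearMap.adjoint_inner_right]

/-- Support functions pull back along the adjoint, and a compact convex set is determined by its
support function. No injectivity is needed, so every zonotope is an image of one fixed coefficient
body. -/
theorem orliczZonotope_map (hφ : OrliczClass φ) {m : ℕ}
    (g : EuclideanSpace ℝ (Fin n) →ₗ[ℝ] EuclideanSpace ℝ (Fin m))
    (Λ : Multiset (EuclideanSpace ℝ (Fin n))) :
    orliczZonotope φ (Λ.map g) = g '' orliczZonotope φ Λ := by
  symm
  rw [← orliczZonotope_unique hφ]
  refine ⟨(isCompact_orliczZonotope φ Λ).image g.continuous_of_finiteDimensional,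
    (convex_orliczZonotope φ Λ).linear_image g, fun u => ?_⟩
  rw [orliczSupport_map, Set.image_image]
  simpa only [LinearMap.adjoint_inner_right] using
    isGreatest_orliczSupport hφ Λ (LinearMap.adjoint g u)

theorem exists_map_canonicalBasis_eq {k : ℕ} (v : Fin k → EuclideanSpace ℝ (Fin n)) :
    ∃ g : EuclideanSpace ℝ (Fin k) →ₗ[ℝ] EuclideanSpace ℝ (Fin n),
      Finset.univ.val.map v = (canonicalBasis k).map g ∧ ∀ a, g a = ∑ i, a i • v i := by
  refine ⟨(EuclideanSpace.basisFun (Fin k) ℝ).toBasis.constr ℝ v, ?_, fun a => by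
    simp [Module.Basis.constr_apply_fintype]⟩
  rw [canonicalBasis, Multiset.map_map]
  refine Multiset.map_congr rfl fun i _ => ?_
  have := (EuclideanSpace.basisFun (Fin k) ℝ).toBasis.constr_basis ℝ v i
  rw [OrthonormalBasis.coe_toBasis, EuclideanSpace.basisFun_apply] at this
  exact this.symm

/-- An Orlicz zonotope is the set of all combinations of the generating vectors with coefficients
in the Orlicz zonotope of the canonical basis. -/
theorem mem_orliczZonotope_iff (hφ : OrliczClass φ) {k : ℕ}
    (v : Fin k → EuclideanSpace ℝ (Fin n)) (x : EuclideanSpace ℝ (Fin n)) :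
    x ∈ orliczZonotope φ (Finset.univ.val.map v) ↔
      ∃ a ∈ orliczZonotope φ (canonicalBasis k), x = ∑ i, a i • v i := by
  obtain ⟨g, h, hg⟩ := exists_map_canonicalBasis_eq v
  rw [h, orliczZonotope_map hφ]
  simp only [Set.mem_image, hg, eq_comm]

theorem orliczSupport_canonicalBasis {k : ℕ} (x : EuclideanSpace ℝ (Fin k)) :
    orliczSupport φ (canonicalBasis k) x =
      sInf {r : ℝ | 0 < r ∧ ∑ i, φ (max 0 (x i) / r) ≤ 1} := by
  simp only [orliczSupport, canonicalBasis, Multiset.map_map, Function.comp_def,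
    Finset.sum_map_val, EuclideanSpace.inner_single_left, map_one, one_mul]

theorem orlicz_coeff_nonneg (hφ : OrliczClass φ) {k : ℕ} {a : EuclideanSpace ℝ (Fin k)}
    (ha : a ∈ orliczZonotope φ (canonicalBasis k)) (i : Fin k) : 0 ≤ a i := by
  have h := ha (-EuclideanSpace.single i 1)
  rw [orliczSupport_eq_zero hφ] at h
  · simpa [EuclideanSpace.inner_single_right] using h
  · intro w hw
    obtain ⟨j, -, rfl⟩ := Multiset.mem_map.1 hw
    rw [inner_neg_right, EuclideanSpace.inner_single_left]
    simp only [map_one, one_mul, PiLp.single_apply]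
    split_ifs <;> norm_num

/-- The support function sees only the positive part of x, so the condition on a may be tested
there, where shrinking nonnegative coefficients lowers the inner product. -/
theorem orlicz_coeff_mono {k : ℕ} {a b : EuclideanSpace ℝ (Fin k)}
    (ha : a ∈ orliczZonotope φ (canonicalBasis k)) (hb : ∀ i, 0 ≤ b i) (hab : ∀ i, b i ≤ a i) :
    b ∈ orliczZonotope φ (canonicalBasis k) := by
  intro x
  have h := ha (WithLp.toLp 2 fun i => max 0 (x i))
  have h1 : orliczSupport φ (canonicalBasis k) (WithLp.toLp 2 fun i => max 0 (x i)) =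
      orliczSupport φ (canonicalBasis k) x := by
    simp [orliczSupport_canonicalBasis]
  rw [h1] at h
  refine le_trans ?_ h
  simp only [PiLp.inner_apply, RCLike.inner_apply, conj_trivial]
  refine Finset.sum_le_sum fun i _ => ?_
  have h2 := le_max_left 0 (x i)
  have h3 := le_max_right 0 (x i)
  nlinarith [hb i, hab i, mul_le_mul_of_nonneg_right h3 (hb i),
    mul_le_mul_of_nonneg_left (hab i) h2]

/-- For the identity the coefficients are not coupled: they can be exchanged one at a time. -/
theorem mem_cube_iff {k : ℕ} {a : EuclideanSpace ℝ (Fin k)} :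
    a ∈ orliczZonotope (fun t => t) (canonicalBasis k) ↔ ∀ i, 0 ≤ a i ∧ a i ≤ 1 := by
  constructor
  · refine fun ha i => ⟨orlicz_coeff_nonneg orliczClass_id ha i, ?_⟩
    have h := ha (EuclideanSpace.single i 1)
    rw [orliczSupport_id] at h
    simp only [EuclideanSpace.inner_single_right, conj_trivial, one_mul, canonicalBasis,
      Multiset.map_map, Function.comp_def, Finset.sum_map_val] at h
    refine h.trans ?_
    rw [Finset.sum_eq_single i (fun j _ hj => by simp [hj.symm]) (by simp)]
    simp
  · intro ha x
    rw [orliczSupport_id]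
    simp only [EuclideanSpace.inner_single_left, map_one, one_mul, canonicalBasis,
      Multiset.map_map, Function.comp_def, Finset.sum_map_val]
    simp only [PiLp.inner_apply, RCLike.inner_apply, conj_trivial]
    refine Finset.sum_le_sum fun i _ => ?_
    have h2 := le_max_left 0 (x i)
    have h3 := le_max_right 0 (x i)
    nlinarith [ha i, mul_le_mul_of_nonneg_right h3 (ha i).1,
      mul_le_mul_of_nonneg_left (ha i).2 h2]

end Support

/-! ### Slicing along a line -/

section Fibers

open scoped Pointwise

theorem exists_eq_Icc_of_isCompact_convex {A : Set ℝ} (hA : IsCompact A) (hA' : Convex ℝ A)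
    (hne : A.Nonempty) : ∃ a b, a ≤ b ∧ A = Set.Icc a b :=
  ⟨sInf A, sSup A, csInf_le_csSup hne hA.bddBelow hA.bddAbove,
    eq_Icc_of_connected_compact ⟨hne, hA'.isPreconnected⟩ hA⟩

theorem volume_add_of_isCompact_convex {A B : Set ℝ} (hA : IsCompact A) (hA' : Convex ℝ A)
    (hB : IsCompact B) (hB' : Convex ℝ B) (hAne : A.Nonempty) (hBne : B.Nonempty) :
    volume (A + B) = volume A + volume B := by
  obtain ⟨a, b, hab, rfl⟩ := exists_eq_Icc_of_isCompact_convex hA hA' hAne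
  obtain ⟨c, d, hcd, rfl⟩ := exists_eq_Icc_of_isCompact_convex hB hB' hBne
  rw [Set.Icc_add_Icc hab hcd, Real.volume_Icc, Real.volume_Icc, Real.volume_Icc,
    ← ENNReal.ofReal_add (by linarith) (by linarith)]
  congr 1
  ring

theorem volume_le_of_subset_add {X A B : Set ℝ} (hA : IsCompact A) (hA' : Convex ℝ A)
    (hB : IsCompact B) (hB' : Convex ℝ B) (h : X ⊆ A + B) :
    volume X ≤ volume A + volume B := by
  rcases X.eq_empty_or_nonempty with rfl | ⟨x, hx⟩
  · simp
  · obtain ⟨a, ha, b, hb, -⟩ := h hx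
    rw [← volume_add_of_isCompact_convex hA hA' hB hB' ⟨a, ha⟩ ⟨b, hb⟩]
    exact measure_mono h

variable {n : ℕ}

/-- The orthogonal projection onto the hyperplane orthogonal to `w`. -/
noncomputable def hyperplaneProj (w : EuclideanSpace ℝ (Fin n)) :
    EuclideanSpace ℝ (Fin n) →ₗ[ℝ] EuclideanSpace ℝ (Fin n) :=
  LinearMap.id - ((innerₛₗ ℝ w).smulRight ((‖w‖ ^ 2)⁻¹ • w))

theorem hyperplaneProj_apply (w x : EuclideanSpace ℝ (Fin n)) :
    hyperplaneProj w x = x - (inner ℝ w x / ‖w‖ ^ 2) • w := by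
  simp [hyperplaneProj, smul_smul, div_eq_mul_inv]

theorem inner_hyperplaneProj {w : EuclideanSpace ℝ (Fin n)} (hw : w ≠ 0)
    (x : EuclideanSpace ℝ (Fin n)) : inner ℝ w (hyperplaneProj w x) = 0 := by
  have : ‖w‖ ≠ 0 := norm_ne_zero_iff.2 hw
  rw [hyperplaneProj_apply, inner_sub_right, real_inner_smul_right, real_inner_self_eq_norm_sq]
  field_simp
  ring

theorem hyperplaneProj_eq_self {w x : EuclideanSpace ℝ (Fin n)} (h : inner ℝ w x = 0) :
    hyperplaneProj w x = x := by
  simp [hyperplaneProj_apply, h]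

theorem eq_smul_add_hyperplaneProj (w x : EuclideanSpace ℝ (Fin n)) :
    x = (inner ℝ w x / ‖w‖ ^ 2) • w + hyperplaneProj w x := by
  simp [hyperplaneProj_apply]

theorem inner_hyperplaneProj_hyperplaneProj {w : EuclideanSpace ℝ (Fin n)} (hw : w ≠ 0)
    (x y : EuclideanSpace ℝ (Fin n)) :
    inner ℝ (hyperplaneProj w x) (hyperplaneProj w y) =
      inner ℝ x y - inner ℝ w x * inner ℝ w y / ‖w‖ ^ 2 := by
  nth_rw 1 [hyperplaneProj_apply]
  rw [inner_sub_left, real_inner_smul_left, inner_hyperplaneProj hw, hyperplaneProj_apply,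
    inner_sub_right, real_inner_smul_right, real_inner_comm w x]
  ring

/-- Decomposition of the space into the line spanned by `w` and its orthogonal complement. -/
noncomputable def lineSplit {w : EuclideanSpace ℝ (Fin n)} (hw : w ≠ 0) :
    EuclideanSpace ℝ (Fin n) ≃ₗ[ℝ] (ℝ ∙ w)ᗮ × ℝ where
  toFun x := (⟨hyperplaneProj w x, Submodule.mem_orthogonal_singleton_iff_inner_right.2
    (inner_hyperplaneProj hw x)⟩, inner ℝ w x / ‖w‖ ^ 2)
  map_add' x y := by
    ext1
    · ext1; simp
    · simp [inner_add_right, add_div]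
  map_smul' c x := by
    ext1
    · ext1; simp
    · simp [real_inner_smul_right, mul_div_assoc]
  invFun p := p.2 • w + p.1
  left_inv x := (eq_smul_add_hyperplaneProj w x).symm
  right_inv p := by
    have h : inner ℝ w (p.1 : EuclideanSpace ℝ (Fin n)) = 0 :=
      Submodule.mem_orthogonal_singleton_iff_inner_right.1 p.1.2
    have hw' : ‖w‖ ≠ 0 := norm_ne_zero_iff.2 hw
    have h2 : inner ℝ w (p.2 • w + (p.1 : EuclideanSpace ℝ (Fin n))) / ‖w‖ ^ 2 = p.2 := by
      rw [inner_add_right, h, real_inner_smul_right, real_inner_self_eq_norm_sq]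
      field_simp
      ring
    ext1
    · ext1
      simp only [hyperplaneProj_apply, h2]
      simp
    · exact h2

/-- Fubini's theorem for the fibres parallel to a line, up to a normalization of the measure. -/
theorem exists_volume_eq_lintegral_fibers {w : EuclideanSpace ℝ (Fin n)} (hw : w ≠ 0) :
    ∃ c : ENNReal, ∀ S : Set (EuclideanSpace ℝ (Fin n)), MeasurableSet S →
      volume S = c * ∫⁻ y : (ℝ ∙ w)ᗮ,
        volume {r : ℝ | r • w + (y : EuclideanSpace ℝ (Fin n)) ∈ S} := by
  let L := (lineSplit hw).toContinuousLinearEquiv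
  let μ : Measure (EuclideanSpace ℝ (Fin n)) :=
    ((volume : Measure (ℝ ∙ w)ᗮ).prod (volume : Measure ℝ)).map L.symm
  have : μ.IsAddHaarMeasure := L.symm.isAddHaarMeasure_map _
  -- Uniqueness of Haar measure gives a factor; its value is irrelevant because it is common to all
  -- volumes compared.
  refine ⟨Measure.addHaarScalarFactor volume μ, fun S hS => ?_⟩
  have h := Measure.isAddLeftInvariant_eq_smul (volume : Measure (EuclideanSpace ℝ (Fin n))) μ
  conv_lhs => rw [h]
  rw [Measure.smul_apply, Measure.map_apply L.symm.continuous.measurable hS,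
    Measure.prod_apply (L.symm.continuous.measurable hS)]
  rfl

theorem measurable_volume_fibers {w : EuclideanSpace ℝ (Fin n)} (hw : w ≠ 0)
    {S : Set (EuclideanSpace ℝ (Fin n))} (hS : MeasurableSet S) :
    Measurable fun y : (ℝ ∙ w)ᗮ =>
      volume {r : ℝ | r • w + (y : EuclideanSpace ℝ (Fin n)) ∈ S} :=
  measurable_measure_prodMk_left
    ((lineSplit hw).toContinuousLinearEquiv.symm.continuous.measurable hS)

theorem isCompact_fiber {w : EuclideanSpace ℝ (Fin n)} (hw : w ≠ 0)
    {S : Set (EuclideanSpace ℝ (Fin n))} (hS : IsCompact S) (y : EuclideanSpace ℝ (Fin n)) :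
    IsCompact {r : ℝ | r • w + y ∈ S} := by
  have : Topology.IsClosedEmbedding fun r : ℝ => r • w + y :=
    (Homeomorph.addRight y).isClosedEmbedding.comp (isClosedEmbedding_smul_left hw)
  exact this.isCompact_preimage hS

theorem convex_fiber (w : EuclideanSpace ℝ (Fin n)) {S : Set (EuclideanSpace ℝ (Fin n))}
    (hS : Convex ℝ S) (y : EuclideanSpace ℝ (Fin n)) : Convex ℝ {r : ℝ | r • w + y ∈ S} := by
  intro r hr s hs a b ha hb hab
  obtain rfl : b = 1 - a := by linarith
  have := hS hr hs ha hb hab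
  rw [Set.mem_ofPred_eq]
  convert this using 1
  module

end Fibers

/-! ### Deletion–contraction for volumes -/

section DeletionContraction

open scoped Pointwise

variable {n : ℕ} {φ : ℝ → ℝ}

theorem exists_eq_map_fin {α : Type*} (Λ : Multiset α) :
    ∃ (k : ℕ) (v : Fin k → α), Λ = Finset.univ.val.map v := by
  induction Λ using Quotient.inductionOn with
  | h l => exact ⟨l.length, l.get, by simp [Fin.univ_val_map]⟩

theorem map_fin_cons {α : Type*} {k : ℕ} (w : α) (v : Fin k → α) :
    Finset.univ.val.map (Fin.cons w v : Fin (k + 1) → α) = w ::ₘ Finset.univ.val.map v := by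
  simp [Fin.univ_val_map, List.ofFn_succ]

theorem mem_orliczZonotope_cons_iff (hφ : OrliczClass φ) {k : ℕ}
    (w : EuclideanSpace ℝ (Fin n)) (v : Fin k → EuclideanSpace ℝ (Fin n))
    (x : EuclideanSpace ℝ (Fin n)) :
    x ∈ orliczZonotope φ (w ::ₘ Finset.univ.val.map v) ↔
      ∃ a ∈ orliczZonotope φ (canonicalBasis (k + 1)), x = a 0 • w + ∑ i : Fin k, a i.succ • v i := by
  rw [← map_fin_cons, mem_orliczZonotope_iff hφ]
  simp [Fin.sum_univ_succ]

/-- Deletion is replacement of a generator by 0. Both zonotopes then share one coefficient body in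
dimension k + 1. -/
theorem mem_orliczZonotope_tail_iff (hφ : OrliczClass φ) {k : ℕ}
    (v : Fin k → EuclideanSpace ℝ (Fin n)) (x : EuclideanSpace ℝ (Fin n)) :
    x ∈ orliczZonotope φ (Finset.univ.val.map v) ↔
      ∃ a ∈ orliczZonotope φ (canonicalBasis (k + 1)), x = ∑ i : Fin k, a i.succ • v i := by
  rw [← orliczZonotope_zero_cons hφ, mem_orliczZonotope_cons_iff hφ]
  simp

theorem orliczZonotope_subset_cons (hφ : OrliczClass φ) (w : EuclideanSpace ℝ (Fin n))
    (Λ : Multiset (EuclideanSpace ℝ (Fin n))) :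
    orliczZonotope φ Λ ⊆ orliczZonotope φ (w ::ₘ Λ) := by
  obtain ⟨k, v, rfl⟩ := exists_eq_map_fin Λ
  intro x hx
  obtain ⟨a, ha, rfl⟩ := (mem_orliczZonotope_tail_iff hφ v x).1 hx
  refine (mem_orliczZonotope_cons_iff hφ w v _).2
    ⟨WithLp.toLp 2 (Fin.cons 0 fun i => a i.succ), orlicz_coeff_mono ha ?_ ?_, by simp⟩
  all_goals
    refine Fin.cases ?_ fun i => ?_
    · simp [orlicz_coeff_nonneg hφ ha]
    · simp [orlicz_coeff_nonneg hφ ha]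

theorem smul_add_eq_smul_add_iff {w y z : EuclideanSpace ℝ (Fin n)} (hw : w ≠ 0)
    (hy : inner ℝ w y = 0) (hz : inner ℝ w z = 0) {r s : ℝ} :
    r • w + y = s • w + z ↔ r = s ∧ y = z := by
  refine ⟨fun h => ?_, by rintro ⟨rfl, rfl⟩; rfl⟩
  have h1 : r = s := by
    have := congrArg (inner ℝ w) h
    simp only [inner_add_right, hy, hz, real_inner_smul_right, add_zero] at this
    exact mul_right_cancel₀ (inner_self_ne_zero.2 hw) this
  subst h1
  exact ⟨rfl, add_left_cancel h⟩

theorem inner_sum_hyperplaneProj {w : EuclideanSpace ℝ (Fin n)} (hw : w ≠ 0) {k : ℕ}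
    (v : Fin k → EuclideanSpace ℝ (Fin n)) (a : Fin k → ℝ) :
    inner ℝ w (∑ i, a i • hyperplaneProj w (v i)) = 0 := by
  simp [inner_sum, real_inner_smul_right, inner_hyperplaneProj hw]

theorem sum_smul_eq_smul_add (w : EuclideanSpace ℝ (Fin n)) {k : ℕ}
    (v : Fin k → EuclideanSpace ℝ (Fin n)) (a : Fin k → ℝ) :
    ∑ i, a i • v i = (∑ i, a i * (inner ℝ w (v i) / ‖w‖ ^ 2)) • w +
      ∑ i, a i • hyperplaneProj w (v i) := by
  rw [Finset.sum_smul, ← Finset.sum_add_distrib]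
  refine Finset.sum_congr rfl fun i _ => ?_
  rw [mul_smul, ← smul_add, ← eq_smul_add_hyperplaneProj]

/-- Deletion–contraction inequality for the volume of an Orlicz zonotope. -/
theorem volume_orliczZonotope_cons_le (hφ : OrliczClass φ) {w : EuclideanSpace ℝ (Fin n)}
    (hw : w ≠ 0) (Λ : Multiset (EuclideanSpace ℝ (Fin n))) :
    volume (orliczZonotope φ (w ::ₘ Λ)) ≤ volume (orliczZonotope φ Λ) +
      volume (orliczZonotope φ (w ::ₘ Λ.map (hyperplaneProj w))) := by
  obtain ⟨c, hc⟩ := exists_volume_eq_lintegral_fibers hw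
  have hmeas (Γ) := (isCompact_orliczZonotope (n := n) φ Γ).measurableSet
  rw [hc _ (hmeas _), hc _ (hmeas _), hc _ (hmeas _), ← mul_add,
    ← lintegral_add_left (measurable_volume_fibers hw (hmeas _))]
  gcongr with y
  have hy : inner ℝ w (y : EuclideanSpace ℝ (Fin n)) = 0 :=
    Submodule.mem_orthogonal_singleton_iff_inner_right.1 y.2
  refine volume_le_of_subset_add (isCompact_fiber hw (isCompact_orliczZonotope φ _) _)
    (convex_fiber w (convex_orliczZonotope φ _) _)
    (isCompact_fiber hw (isCompact_orliczZonotope φ _) _)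
    (convex_fiber w (convex_orliczZonotope φ _) _) ?_
  obtain ⟨k, v, rfl⟩ := exists_eq_map_fin Λ
  intro r hr
  obtain ⟨a, ha, h⟩ := (mem_orliczZonotope_cons_iff hφ w v _).1 hr
  have h' := h
  rw [sum_smul_eq_smul_add w v fun i => a i.succ, ← add_assoc, ← add_smul,
    smul_add_eq_smul_add_iff hw hy (inner_sum_hyperplaneProj hw v _)] at h'
  -- The same coefficient vector serves twice: without its w-term in the deletion, with it in the
  -- contraction.
  refine Set.mem_add.2 ⟨r - a 0, ?_, a 0, ?_, by ring⟩
  · refine (mem_orliczZonotope_tail_iff hφ v _).2 ⟨a, ha, ?_⟩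
    rw [sub_smul, sub_add_eq_add_sub, h, add_sub_cancel_left]
  · rw [Set.mem_ofPred_eq, Multiset.map_map]
    exact (mem_orliczZonotope_cons_iff hφ w _ _).2 ⟨a, ha, by rw [h'.2]; rfl⟩

/-- `H` is the reverse inclusion of fibres, so lengths add exactly. -/
theorem volume_orliczZonotope_cons_eq (hφ : OrliczClass φ) {w : EuclideanSpace ℝ (Fin n)}
    (hw : w ≠ 0) (Λ : Multiset (EuclideanSpace ℝ (Fin n)))
    (H : ∀ y, inner ℝ w y = 0 → ∀ s t : ℝ, s • w + y ∈ orliczZonotope φ Λ →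
      t • w + y ∈ orliczZonotope φ (w ::ₘ Λ.map (hyperplaneProj w)) →
      (s + t) • w + y ∈ orliczZonotope φ (w ::ₘ Λ)) :
    volume (orliczZonotope φ (w ::ₘ Λ)) = volume (orliczZonotope φ Λ) +
      volume (orliczZonotope φ (w ::ₘ Λ.map (hyperplaneProj w))) := by
  refine le_antisymm (volume_orliczZonotope_cons_le hφ hw Λ) ?_
  obtain ⟨c, hc⟩ := exists_volume_eq_lintegral_fibers hw
  have hmeas (Γ) := (isCompact_orliczZonotope (n := n) φ Γ).measurableSet
  rw [hc _ (hmeas _), hc _ (hmeas _), hc _ (hmeas _), ← mul_add,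
    ← lintegral_add_left (measurable_volume_fibers hw (hmeas _))]
  gcongr with y
  have hy : inner ℝ w (y : EuclideanSpace ℝ (Fin n)) = 0 :=
    Submodule.mem_orthogonal_singleton_iff_inner_right.1 y.2
  -- Both fibres are nonempty exactly over the projection of the zonotope of Λ. Otherwise one empty
  -- summand would destroy additivity.
  have hne : {r : ℝ | r • w + (y : EuclideanSpace ℝ (Fin n)) ∈ orliczZonotope φ Λ}.Nonempty ↔
      {r : ℝ | r • w + (y : EuclideanSpace ℝ (Fin n)) ∈
        orliczZonotope φ (w ::ₘ Λ.map (hyperplaneProj w))}.Nonempty := by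
    obtain ⟨k, v, rfl⟩ := exists_eq_map_fin Λ
    rw [Multiset.map_map]
    constructor
    · rintro ⟨s, hs⟩
      obtain ⟨a, ha, h⟩ := (mem_orliczZonotope_tail_iff hφ v _).1 hs
      rw [sum_smul_eq_smul_add w v fun i => a i.succ,
        smul_add_eq_smul_add_iff hw hy (inner_sum_hyperplaneProj hw v _)] at h
      exact ⟨a 0, (mem_orliczZonotope_cons_iff hφ w _ _).2 ⟨a, ha, by rw [h.2]; rfl⟩⟩
    · rintro ⟨t, ht⟩
      obtain ⟨b, hb, h⟩ := (mem_orliczZonotope_cons_iff hφ w _ _).1 ht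
      have h' := ((smul_add_eq_smul_add_iff hw hy (inner_sum_hyperplaneProj hw v _)).1 h).2
      refine ⟨∑ i : Fin k, b i.succ * (inner ℝ w (v i) / ‖w‖ ^ 2),
        (mem_orliczZonotope_tail_iff hφ v _).2 ⟨b, hb, ?_⟩⟩
      rw [h', ← sum_smul_eq_smul_add]
  rcases Set.eq_empty_or_nonempty
    {r : ℝ | r • w + (y : EuclideanSpace ℝ (Fin n)) ∈ orliczZonotope φ Λ} with h | h
  · have h' : {r : ℝ | r • w + (y : EuclideanSpace ℝ (Fin n)) ∈
        orliczZonotope φ (w ::ₘ Λ.map (hyperplaneProj w))} = ∅ := by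
      rw [← Set.not_nonempty_iff_eq_empty, ← hne, h]
      exact Set.not_nonempty_empty
    rw [h, h']
    simp
  · rw [← volume_add_of_isCompact_convex (isCompact_fiber hw (isCompact_orliczZonotope φ _) _)
      (convex_fiber w (convex_orliczZonotope φ _) _)
      (isCompact_fiber hw (isCompact_orliczZonotope φ _) _)
      (convex_fiber w (convex_orliczZonotope φ _) _) h (hne.1 h)]
    refine measure_mono ?_
    rintro _ ⟨s, hs, t, ht, rfl⟩
    exact H y hy s t hs ht

theorem volume_zonotope_cons {w : EuclideanSpace ℝ (Fin n)} (hw : w ≠ 0)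
    (Λ : Multiset (EuclideanSpace ℝ (Fin n))) :
    volume (orliczZonotope (fun t => t) (w ::ₘ Λ)) = volume (orliczZonotope (fun t => t) Λ) +
      volume (orliczZonotope (fun t => t) (w ::ₘ Λ.map (hyperplaneProj w))) := by
  refine volume_orliczZonotope_cons_eq orliczClass_id hw Λ fun y hy s t hs ht => ?_
  obtain ⟨k, v, rfl⟩ := exists_eq_map_fin Λ
  rw [Multiset.map_map] at ht
  obtain ⟨a, ha, h⟩ := (mem_orliczZonotope_tail_iff orliczClass_id v _).1 hs
  obtain ⟨b, hb, h'⟩ := (mem_orliczZonotope_cons_iff orliczClass_id w _ _).1 ht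
  have ht := ((smul_add_eq_smul_add_iff hw hy (inner_sum_hyperplaneProj hw v _)).1 h').1
  -- In a cube the w-coefficient of one representation may be combined with the remaining
  -- coefficients of the other.
  refine (mem_orliczZonotope_cons_iff orliczClass_id w v _).2
    ⟨WithLp.toLp 2 (Fin.cons (b 0) fun i => a i.succ), mem_cube_iff.2 ?_, ?_⟩
  · exact Fin.cases (by simpa using mem_cube_iff.1 hb 0) fun i => by
      simpa using mem_cube_iff.1 ha i.succ
  · simp only [Fin.cons_zero, Fin.cons_succ]
    rw [← h, ht]
    module

/-- Points of the two fibres give two representations of y by the projected vectors. These are again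
obtuse, which lets the minimum of the coefficients replace both; this minimum may be joined to b 0
without leaving the coefficient body. -/
theorem volume_orliczZonotope_cons_of_obtuse (hφ : OrliczClass φ) {k : ℕ}
    {w : EuclideanSpace ℝ (Fin n)} (hw : w ≠ 0) (v : Fin k → EuclideanSpace ℝ (Fin n))
    (hwv : ∀ i, inner ℝ w (v i) ≤ 0) (hv : ∀ i j, i ≠ j → inner ℝ (v i) (v j) ≤ 0) :
    volume (orliczZonotope φ (w ::ₘ Finset.univ.val.map v)) =
      volume (orliczZonotope φ (Finset.univ.val.map v)) +
      volume (orliczZonotope φ (w ::ₘ (Finset.univ.val.map v).map (hyperplaneProj w))) := by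
  refine volume_orliczZonotope_cons_eq hφ hw _ fun y hy s t hs ht => ?_
  have hsX := orliczZonotope_subset_cons hφ w _ hs
  rw [Multiset.map_map] at ht
  obtain ⟨a, ha, h⟩ := (mem_orliczZonotope_tail_iff hφ v _).1 hs
  obtain ⟨b, hb, h'⟩ := (mem_orliczZonotope_cons_iff hφ w _ _).1 ht
  rw [sum_smul_eq_smul_add w v fun i => a i.succ,
    smul_add_eq_smul_add_iff hw hy (inner_sum_hyperplaneProj hw v _)] at h
  replace h' := (smul_add_eq_smul_add_iff hw hy (inner_sum_hyperplaneProj hw v _)).1 h'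
  set p : Fin k → EuclideanSpace ℝ (Fin n) := fun i => hyperplaneProj w (v i) with hp
  have hpp (i j) (hij : i ≠ j) : inner ℝ (p i) (p j) ≤ 0 := by
    rw [hp, inner_hyperplaneProj_hyperplaneProj hw]
    have := div_nonneg (mul_nonneg_of_nonpos_of_nonpos (hwv i) (hwv j)) (sq_nonneg ‖w‖)
    linarith [hv i j hij]
  set c : Fin k → ℝ := fun i => min (a i.succ) (b i.succ) with hc
  -- the componentwise minimum of two representations of `y` is again one
  have hyc : (y : EuclideanSpace ℝ (Fin n)) = ∑ i, c i • p i := by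
    have h1 : y - ∑ i, c i • p i = ∑ i, (a i.succ - c i) • p i := by
      simp only [sub_smul, Finset.sum_sub_distrib]
      rw [← h.2]
    have h2 : y - ∑ i, c i • p i = ∑ i, (b i.succ - c i) • p i := by
      simp only [sub_smul, Finset.sum_sub_distrib]
      congr 1
      exact h'.2
    -- Expand the squared norm of the difference using one representation in each factor: diagonal
    -- terms vanish, because one of a - c, b - c does, and the others are nonpositive.
    rw [← sub_eq_zero, ← real_inner_self_nonpos]
    nth_rw 1 [h1]
    rw [h2]
    simp only [sum_inner, inner_sum, real_inner_smul_left,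
      real_inner_smul_right]
    refine Finset.sum_nonpos fun i _ => Finset.sum_nonpos fun j _ => ?_
    have haj : 0 ≤ a j.succ - c j := sub_nonneg.2 (min_le_left _ _)
    have hbi : 0 ≤ b i.succ - c i := sub_nonneg.2 (min_le_right _ _)
    rcases eq_or_ne i j with rfl | hij
    · have : (a i.succ - c i) * (b i.succ - c i) = 0 := by
        rcases le_total (a i.succ) (b i.succ) with hab | hab <;> simp [hc, hab]
      rw [← mul_assoc, mul_comm (b i.succ - c i), this, zero_mul]
    · exact mul_nonpos_of_nonneg_of_nonpos hbi
        (mul_nonpos_of_nonneg_of_nonpos haj (hpp j i hij.symm))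
  have hrX : (b 0 + ∑ i, c i * (inner ℝ w (v i) / ‖w‖ ^ 2)) • w + y ∈
      orliczZonotope φ (w ::ₘ Finset.univ.val.map v) := by
    refine (mem_orliczZonotope_cons_iff hφ w v _).2
      ⟨WithLp.toLp 2 (Fin.cons (b 0) c), orlicz_coeff_mono hb ?_ ?_, ?_⟩
    · exact Fin.cases (by simpa using orlicz_coeff_nonneg hφ hb 0) fun i => by
        simpa [hc] using ⟨orlicz_coeff_nonneg hφ ha _, orlicz_coeff_nonneg hφ hb _⟩
    · exact Fin.cases (by simp) fun i => by simp [hc]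
    · simp only [Fin.cons_zero, Fin.cons_succ]
      rw [sum_smul_eq_smul_add w v c, hyc, add_smul, add_assoc]
  -- The fibre is an interval containing s and a point at least s + t: lowering coefficients of
  -- vectors with nonpositive w-component moves the point up along w.
  refine (convex_fiber w (convex_orliczZonotope φ _) y).ordConnected.out hsX hrX ⟨?_, ?_⟩
  · rw [h'.1]
    exact le_add_of_nonneg_right (orlicz_coeff_nonneg hφ hb 0)
  · rw [h'.1, h.1, add_comm]
    refine add_le_add_right (Finset.sum_le_sum fun i _ => ?_) _
    exact mul_le_mul_of_nonpos_right (min_le_left _ _)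
      (div_nonpos_of_nonpos_of_nonneg (hwv i) (sq_nonneg _))

end DeletionContraction

/-! ### The volume deficit -/

section Deficit

variable {n : ℕ} {φ : ℝ → ℝ}

theorem isSpanning_iff {Λ : Multiset (EuclideanSpace ℝ (Fin n))} :
    IsSpanning Λ ↔ ∀ x, (∀ w ∈ Λ, inner ℝ w x = 0) → x = 0 := by
  rw [IsSpanning, ← Submodule.orthogonal_eq_bot_iff, Submodule.eq_bot_iff]
  refine forall_congr' fun x => ?_
  rw [Submodule.mem_orthogonal]
  refine imp_congr_left ⟨fun h w hw => h w (Submodule.subset_span hw), fun h u hu => ?_⟩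
  induction hu using Submodule.span_induction with
  | mem w hw => exact h w hw
  | zero => simp
  | add u v _ _ hu hv => rw [inner_add_left, hu, hv, add_zero]
  | smul c u _ hu => rw [real_inner_smul_left, hu, mul_zero]

theorem isSpanning_canonicalBasis (n : ℕ) : IsSpanning (canonicalBasis n) := by
  refine isSpanning_iff.2 fun x hx => ?_
  ext i
  simpa [EuclideanSpace.inner_single_left] using
    hx (EuclideanSpace.single i 1) (Multiset.mem_map_of_mem _ (Finset.mem_univ_val i))

theorem interior_orliczZonotope_nonempty (hφ : OrliczClass φ)
    {Λ : Multiset (EuclideanSpace ℝ (Fin n))} (hΛ : IsSpanning Λ) :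
    (interior (orliczZonotope φ Λ)).Nonempty := by
  rw [(convex_orliczZonotope φ Λ).interior_nonempty_iff_affineSpan_eq_top]
  have h0 : (0 : EuclideanSpace ℝ (Fin n)) ∈ affineSpan ℝ (orliczZonotope φ Λ) :=
    subset_affineSpan ℝ _ (zero_mem_orliczZonotope Λ)
  rw [← AffineSubspace.direction_eq_top_iff_of_nonempty ⟨0, h0⟩, eq_top_iff, ← hΛ,
    Submodule.span_le]
  intro w hw
  have := AffineSubspace.vsub_mem_direction
    (subset_affineSpan ℝ _ (subset_orliczZonotope hφ hw)) h0
  simpa using this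

theorem volume_orliczZonotope_ne_top (φ : ℝ → ℝ) (Λ : Multiset (EuclideanSpace ℝ (Fin n))) :
    volume (orliczZonotope φ Λ) ≠ ⊤ :=
  (isCompact_orliczZonotope φ Λ).measure_ne_top

theorem volume_real_orliczZonotope_pos (hφ : OrliczClass φ)
    {Λ : Multiset (EuclideanSpace ℝ (Fin n))} (hΛ : IsSpanning Λ) :
    0 < volume.real (orliczZonotope φ Λ) :=
  ENNReal.toReal_pos (Measure.measure_pos_of_nonempty_interior _
    (interior_orliczZonotope_nonempty hφ hΛ)).ne' (volume_orliczZonotope_ne_top φ Λ)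

/-- A nonzero u orthogonal to all generators has support 0 in both directions ±u, so the zonotope
lies in a hyperplane. -/
theorem volume_orliczZonotope_eq_zero (hφ : OrliczClass φ)
    {Λ : Multiset (EuclideanSpace ℝ (Fin n))} (hΛ : ¬ IsSpanning Λ) :
    volume (orliczZonotope φ Λ) = 0 := by
  simp only [isSpanning_iff, not_forall] at hΛ
  obtain ⟨u, hu, hu0⟩ := hΛ
  refine measure_mono_null (t := ((ℝ ∙ u)ᗮ : Submodule ℝ (EuclideanSpace ℝ (Fin n)))) ?_
    (Measure.addHaar_submodule _ _ ?_)
  · intro x hx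
    rw [SetLike.mem_coe, Submodule.mem_orthogonal_singleton_iff_inner_left]
    have h1 := hx u
    have h2 := hx (-u)
    rw [orliczSupport_eq_zero hφ fun w hw => (hu w hw).le] at h1
    rw [orliczSupport_eq_zero hφ fun w hw => by rw [inner_neg_right, hu w hw, neg_zero],
      inner_neg_right] at h2
    linarith
  · rw [Ne, Submodule.orthogonal_eq_top_iff, Submodule.span_singleton_eq_bot]
    exact hu0

/-- The amount by which the volume of `Z⁺_φ Λ` falls short of the bound given by the canonical
basis. -/
noncomputable def volumeDeficit (φ : ℝ → ℝ) (Λ : Multiset (EuclideanSpace ℝ (Fin n))) : ℝ :=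
  volumeRatio φ (canonicalBasis n) * volume.real (orliczZonotope (fun t => t) Λ) -
    volume.real (orliczZonotope φ Λ)

theorem volumeDeficit_canonicalBasis (φ : ℝ → ℝ) (n : ℕ) :
    volumeDeficit φ (canonicalBasis n) = 0 := by
  rw [volumeDeficit, volumeRatio, div_mul_cancel₀, sub_self]
  exact (volume_real_orliczZonotope_pos orliczClass_id (isSpanning_canonicalBasis n)).ne'

theorem volumeDeficit_map (hφ : OrliczClass φ)
    (g : EuclideanSpace ℝ (Fin n) →ₗ[ℝ] EuclideanSpace ℝ (Fin n))
    (Λ : Multiset (EuclideanSpace ℝ (Fin n))) :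
    volumeDeficit φ (Λ.map g) = |LinearMap.det g| * volumeDeficit φ Λ := by
  have h {ψ : ℝ → ℝ} (hψ : OrliczClass ψ) : volume.real (orliczZonotope ψ (Λ.map g)) =
      |LinearMap.det g| * volume.real (orliczZonotope ψ Λ) := by
    rw [orliczZonotope_map hψ, Measure.real, Measure.addHaar_image_linearMap, ENNReal.toReal_mul,
      ENNReal.toReal_ofReal (abs_nonneg _), Measure.real]
  rw [volumeDeficit, volumeDeficit, h hφ, h orliczClass_id]
  ring

theorem volumeDeficit_zero_cons (hφ : OrliczClass φ)
    (Λ : Multiset (EuclideanSpace ℝ (Fin n))) :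
    volumeDeficit φ (0 ::ₘ Λ) = volumeDeficit φ Λ := by
  simp only [volumeDeficit, orliczZonotope_zero_cons hφ, orliczZonotope_zero_cons orliczClass_id]

theorem volumeDeficit_nonzeroPart (hφ : OrliczClass φ)
    (Λ : Multiset (EuclideanSpace ℝ (Fin n))) :
    volumeDeficit φ (nonzeroPart Λ) = volumeDeficit φ Λ := by
  simp only [volumeDeficit, orliczZonotope_nonzeroPart hφ,
    orliczZonotope_nonzeroPart orliczClass_id]

theorem volumeDeficit_add_le_cons (hφ : OrliczClass φ) {w : EuclideanSpace ℝ (Fin n)}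
    (hw : w ≠ 0) (Λ : Multiset (EuclideanSpace ℝ (Fin n))) :
    volumeDeficit φ Λ + volumeDeficit φ (w ::ₘ Λ.map (hyperplaneProj w)) ≤
      volumeDeficit φ (w ::ₘ Λ) := by
  have h1 := ENNReal.toReal_mono (ENNReal.add_ne_top.2 ⟨volume_orliczZonotope_ne_top φ Λ,
    volume_orliczZonotope_ne_top φ _⟩) (volume_orliczZonotope_cons_le hφ hw Λ)
  have h2 := congrArg ENNReal.toReal (volume_zonotope_cons hw Λ)
  rw [ENNReal.toReal_add (volume_orliczZonotope_ne_top _ _) (volume_orliczZonotope_ne_top _ _)]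
    at h1 h2
  simp only [volumeDeficit, Measure.real, h2, mul_add]
  linarith

theorem volumeDeficit_cons_of_obtuse (hφ : OrliczClass φ) {w : EuclideanSpace ℝ (Fin n)}
    (hw : w ≠ 0) (l : List (EuclideanSpace ℝ (Fin n)))
    (hl : (w :: l).Pairwise fun u v => inner ℝ u v ≤ 0) :
    volumeDeficit φ ((w :: l : List _) : Multiset (EuclideanSpace ℝ (Fin n))) =
      volumeDeficit φ (l : Multiset (EuclideanSpace ℝ (Fin n))) + volumeDeficit φ
        ((w :: l.map (hyperplaneProj w) : List _) : Multiset (EuclideanSpace ℝ (Fin n))) := by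
  rw [List.pairwise_cons] at hl
  have hv (i j : Fin l.length) (hij : i ≠ j) : inner ℝ (l.get i) (l.get j) ≤ 0 := by
    rcases hij.lt_or_gt with h | h
    · exact List.pairwise_iff_get.1 hl.2 i j h
    · rw [real_inner_comm]
      exact List.pairwise_iff_get.1 hl.2 j i h
  have h1 := congrArg ENNReal.toReal (volume_orliczZonotope_cons_of_obtuse hφ hw l.get
    (fun i => hl.1 _ (l.get_mem i)) hv)
  have h2 := congrArg ENNReal.toReal (volume_zonotope_cons hw l)
  rw [ENNReal.toReal_add (volume_orliczZonotope_ne_top _ _) (volume_orliczZonotope_ne_top _ _)]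
    at h1 h2
  simp only [Fin.univ_val_map, List.ofFn_get] at h1
  simp only [volumeDeficit, Measure.real, ← Multiset.cons_coe, ← Multiset.map_coe, h1, h2, mul_add]
  ring

/-- Such a family is either an image of the canonical basis or not spanning, in which case both
volumes vanish. -/
theorem volumeDeficit_of_orthogonal (hφ : OrliczClass φ) (l : List (EuclideanSpace ℝ (Fin n)))
    (hl : l.Pairwise fun u v => inner ℝ u v = 0) (h0 : ∀ u ∈ l, u ≠ 0) :
    volumeDeficit φ (l : Multiset (EuclideanSpace ℝ (Fin n))) = 0 := by
  by_cases hs : IsSpanning (l : Multiset (EuclideanSpace ℝ (Fin n)))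
  · have hli : LinearIndependent ℝ l.get := by
      refine linearIndependent_of_ne_zero_of_inner_eq_zero (𝕜 := ℝ)
        (fun i => h0 _ (l.get_mem i)) fun i j hij => ?_
      rcases hij.lt_or_gt with h | h
      · exact List.pairwise_iff_get.1 hl i j h
      · rw [real_inner_comm]
        exact List.pairwise_iff_get.1 hl j i h
    have hspan : ⊤ ≤ Submodule.span ℝ (Set.range l.get) := by
      rw [Set.range_list_get]
      exact hs.ge
    have hcard : l.length = n := by
      simpa using (Module.finrank_eq_card_basis (Module.Basis.mk hli hspan)).symm
    -- A free index k allows the length to be substituted for n.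
    have key : ∀ (k : ℕ) (v : Fin k → EuclideanSpace ℝ (Fin n)), k = n →
        volumeDeficit φ (Finset.univ.val.map v) = 0 := by
      rintro k v rfl
      obtain ⟨g, hg, -⟩ := exists_map_canonicalBasis_eq v
      rw [hg, volumeDeficit_map hφ, volumeDeficit_canonicalBasis, mul_zero]
    simpa [Fin.univ_val_map] using key _ l.get hcard
  · simp [volumeDeficit, Measure.real, volume_orliczZonotope_eq_zero hφ hs,
      volume_orliczZonotope_eq_zero orliczClass_id hs]

theorem map_hyperplaneProj_of_orthogonal {w : EuclideanSpace ℝ (Fin n)}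
    {l : List (EuclideanSpace ℝ (Fin n))} (h : ∀ u ∈ l, inner ℝ u w = 0) :
    l.map (hyperplaneProj w) = l := by
  conv_rhs => rw [← List.map_id l]
  refine List.map_congr_left fun u hu => ?_
  rw [id, hyperplaneProj_eq_self]
  rw [real_inner_comm, h u hu]

/-- I collects the vectors already contracted, J those still to be treated. Deletion and contraction
both shorten J, and contraction moves w into I, so the recursion ends at orthogonal families. -/
theorem volumeDeficit_orthogonal_append (hφ : OrliczClass φ) (m : ℕ) :
    ∀ I J : List (EuclideanSpace ℝ (Fin n)), J.length = m →
      I.Pairwise (fun u v => inner ℝ u v = 0) → (∀ u ∈ I, u ≠ 0) →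
      (∀ u ∈ I, ∀ v ∈ J, inner ℝ u v = 0) →
      0 ≤ volumeDeficit φ ((I ++ J : List _) : Multiset (EuclideanSpace ℝ (Fin n))) ∧
      (J.Pairwise (fun u v => inner ℝ u v ≤ 0) →
        volumeDeficit φ ((I ++ J : List _) : Multiset (EuclideanSpace ℝ (Fin n))) = 0) := by
  induction m with
  | zero =>
    intro I J hJ hI h0 _
    obtain rfl := List.length_eq_zero_iff.1 hJ
    rw [List.append_nil, volumeDeficit_of_orthogonal hφ I hI h0]
    exact ⟨le_rfl, fun _ => rfl⟩
  | succ m ih =>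
    rintro I (_ | ⟨w, J⟩) hJ hI h0 hIJ
    · simp at hJ
    have hJm : J.length = m := by simpa using hJ
    have hperm : ((I ++ w :: J : List _) : Multiset (EuclideanSpace ℝ (Fin n))) =
        ((w :: (I ++ J) : List _) : Multiset _) := Multiset.coe_eq_coe.2 List.perm_middle
    have hIJ' : ∀ u ∈ I, ∀ v ∈ J, inner ℝ u v = 0 := fun u hu v hv =>
      hIJ u hu v (List.mem_cons_of_mem _ hv)
    have hdel := ih I J hJm hI h0 hIJ'
    by_cases hw : w = 0
    · rw [hperm, hw, ← Multiset.cons_coe, volumeDeficit_zero_cons hφ]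
      exact ⟨hdel.1, fun h => hdel.2 (List.pairwise_cons.1 h).2⟩
    · have hIw : ∀ u ∈ I, inner ℝ u w = 0 := fun u hu => hIJ u hu w List.mem_cons_self
      have hmap : (I ++ J).map (hyperplaneProj w) = I ++ J.map (hyperplaneProj w) := by
        rw [List.map_append, map_hyperplaneProj_of_orthogonal hIw]
      have hcon := ih (w :: I) (J.map (hyperplaneProj w)) (by simpa using hJm)
        (List.pairwise_cons.2 ⟨fun u hu => by rw [real_inner_comm, hIw u hu], hI⟩)
        (List.forall_mem_cons.2 ⟨hw, h0⟩) (by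
          refine List.forall_mem_cons.2 ⟨?_, fun u hu => ?_⟩
          all_goals
            intro _ hPv
            obtain ⟨v, hv, rfl⟩ := List.mem_map.1 hPv
          · exact inner_hyperplaneProj hw v
          · rw [hyperplaneProj_apply, inner_sub_right, hIJ' u hu v hv, real_inner_smul_right,
              hIw u hu]
            simp)
      have hle := volumeDeficit_add_le_cons hφ hw ((I ++ J : List _) : Multiset _)
      rw [Multiset.map_coe, hmap, Multiset.cons_coe, Multiset.cons_coe, ← hperm] at hle
      refine ⟨(add_nonneg hdel.1 hcon.1).trans hle, fun hob => ?_⟩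
      have hob' := List.pairwise_cons.1 hob
      have heq := volumeDeficit_cons_of_obtuse hφ hw (I ++ J) (by
        refine List.pairwise_cons.2 ⟨?_, List.pairwise_append.2 ⟨hI.imp fun h => h.le, hob'.2,
          fun u hu v hv => (hIJ' u hu v hv).le⟩⟩
        intro u hu
        rcases List.mem_append.1 hu with hu | hu
        · rw [real_inner_comm, hIw u hu]
        · exact hob'.1 u hu)
      rw [hperm, heq, hmap, hdel.2 hob'.2, zero_add]
      refine hcon.2 ?_
      rw [List.pairwise_map]
      refine hob'.2.imp_of_mem fun {u v} hu hv huv => ?_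
      -- Projection subtracts a product of two nonpositive numbers, so obtuseness survives.
      rw [inner_hyperplaneProj_hyperplaneProj hw]
      have := div_nonneg (mul_nonneg_of_nonpos_of_nonpos (hob'.1 u hu) (hob'.1 v hv))
        (sq_nonneg ‖w‖)
      linarith

theorem volumeDeficit_nonneg (hφ : OrliczClass φ) (Λ : Multiset (EuclideanSpace ℝ (Fin n))) :
    0 ≤ volumeDeficit φ Λ := by
  induction Λ using Quotient.inductionOn with
  | h l =>
    exact (volumeDeficit_orthogonal_append hφ l.length [] l rfl (by simp) (by simp) (by simp)).1

theorem volumeDeficit_of_obtuse (hφ : OrliczClass φ) (l : List (EuclideanSpace ℝ (Fin n)))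
    (hl : l.Pairwise fun u v => inner ℝ u v ≤ 0) :
    volumeDeficit φ (l : Multiset (EuclideanSpace ℝ (Fin n))) = 0 :=
  (volumeDeficit_orthogonal_append hφ l.length [] l rfl (by simp) (by simp) (by simp)).2 hl

theorem volumeDeficit_of_isGLImageOfObtuse (hφ : OrliczClass φ)
    {Λ : Multiset (EuclideanSpace ℝ (Fin n))} (h : IsGLImageOfObtuse Λ) :
    volumeDeficit φ Λ = 0 := by
  obtain ⟨S, g, hS, rfl⟩ := h
  have := volumeDeficit_map hφ g.toLinearMap S.val
  rw [LinearEquiv.coe_coe] at this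
  rw [this, ← S.coe_toList, volumeDeficit_of_obtuse hφ, mul_zero]
  refine S.nodup_toList.pairwise_of_forall_ne fun u hu v hv huv => ?_
  exact max_eq_left_iff.1 (hS u (by simpa using hu) v (by simpa using hv) huv)

/-- Drop the nonnegative contraction term of the recursion. -/
theorem volumeDeficit_mono (hφ : OrliczClass φ) {Λ Γ : Multiset (EuclideanSpace ℝ (Fin n))}
    (h : Λ ≤ Γ) : volumeDeficit φ Λ ≤ volumeDeficit φ Γ := by
  obtain ⟨Δ, rfl⟩ := Multiset.le_iff_exists_add.1 h
  clear h
  induction Δ using Multiset.induction with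
  | empty => simp
  | cons w Δ ih =>
    rw [Multiset.add_cons]
    refine ih.trans ?_
    by_cases hw : w = 0
    · rw [hw, volumeDeficit_zero_cons hφ]
    · linarith [volumeDeficit_add_le_cons hφ hw (Λ + Δ),
        volumeDeficit_nonneg hφ (w ::ₘ (Λ + Δ).map (hyperplaneProj w))]

theorem volumeDeficit_map_le_cons (hφ : OrliczClass φ) {w : EuclideanSpace ℝ (Fin n)}
    (hw : w ≠ 0) (Λ : Multiset (EuclideanSpace ℝ (Fin n))) :
    volumeDeficit φ (w ::ₘ Λ.map (hyperplaneProj w)) ≤ volumeDeficit φ (w ::ₘ Λ) := by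
  linarith [volumeDeficit_add_le_cons hφ hw Λ, volumeDeficit_nonneg hφ Λ]

end Deficit

/-! ### Strict positivity of the deficit -/

section Strict

variable {n : ℕ} {φ : ℝ → ℝ}

/-- The interior of G is dense in G, so the open half-space around p cuts off a part of G with
positive volume that misses Z. -/
theorem volume_lt_of_halfspace {Z G : Set (EuclideanSpace ℝ (Fin n))}
    (hZfin : volume Z ≠ ⊤) (hG : Convex ℝ G) (hGint : (interior G).Nonempty) (hZG : Z ⊆ G)
    {u p : EuclideanSpace ℝ (Fin n)} {h : ℝ} (hZu : ∀ x ∈ Z, inner ℝ x u ≤ h) (hp : p ∈ G)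
    (hpu : h < inner ℝ p u) : volume Z < volume G := by
  set O : Set (EuclideanSpace ℝ (Fin n)) := {x | h < inner ℝ x u} with hO
  have hOo : IsOpen O := isOpen_lt continuous_const (by fun_prop)
  have hne : (O ∩ interior G).Nonempty := by
    refine mem_closure_iff.1 ?_ O hOo hpu
    rw [hG.closure_interior_eq_closure_of_nonempty_interior hGint]
    exact subset_closure hp
  have hpos : 0 < volume (O ∩ interior G) :=
    (hOo.inter isOpen_interior).measure_pos volume hne
  have hdisj : Disjoint Z (O ∩ interior G) :=
    Set.disjoint_left.2 fun x hx hx' => (hZu x hx).not_gt hx'.1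
  calc volume Z < volume Z + volume (O ∩ interior G) := ENNReal.lt_add_right hZfin hpos.ne'
    _ = volume (Z ∪ (O ∩ interior G)) :=
      (measure_union hdisj (hOo.inter isOpen_interior).measurableSet).symm
    _ ≤ volume G :=
      measure_mono (Set.union_subset hZG (Set.inter_subset_right.trans interior_subset))

theorem max_zero_inner_smul {c : ℝ} (hc : 0 ≤ c) (v u : EuclideanSpace ℝ (Fin n)) :
    max 0 (inner ℝ (c • v) u) = c * max 0 (inner ℝ v u) := by
  rw [real_inner_smul_left, mul_max_of_nonneg _ _ hc, mul_zero]

theorem zonotope_merge {α β : ℝ} (hα : 0 ≤ α) (hβ : 0 ≤ β) (v : EuclideanSpace ℝ (Fin n))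
    (Λ : Multiset (EuclideanSpace ℝ (Fin n))) :
    orliczZonotope (fun t => t) (α • v ::ₘ β • v ::ₘ Λ) =
      orliczZonotope (fun t => t) ((α + β) • v ::ₘ Λ) := by
  refine orliczZonotope_congr fun u => ?_
  simp only [orliczSupport_id, Multiset.map_cons, Multiset.sum_cons, max_zero_inner_smul hα,
    max_zero_inner_smul hβ, max_zero_inner_smul (add_nonneg hα hβ)]
  ring

theorem orliczSupport_merge_le (hφ : OrliczClass φ) {α β : ℝ} (hα : 0 ≤ α) (hβ : 0 ≤ β)
    (v : EuclideanSpace ℝ (Fin n)) (Λ : Multiset (EuclideanSpace ℝ (Fin n)))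
    (u : EuclideanSpace ℝ (Fin n)) :
    orliczSupport φ (α • v ::ₘ β • v ::ₘ Λ) u ≤ orliczSupport φ ((α + β) • v ::ₘ Λ) u := by
  refine csInf_le_csInf (orlicz_feasible_bddBelow φ _ u) (orlicz_feasible_nonempty hφ _ u) ?_
  rintro r ⟨hr, h⟩
  refine ⟨hr, le_trans ?_ h⟩
  simp only [Multiset.map_cons, Multiset.sum_cons, max_zero_inner_smul hα,
    max_zero_inner_smul hβ, max_zero_inner_smul (add_nonneg hα hβ), ← add_assoc]
  gcongr
  rw [add_mul, add_div]
  exact hφ.superadditive (by positivity) (by positivity)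

/-- A function of the class that is not the identity on `[0, 1]` leaves room for a dilation: the
point `(x, y)` with `x + y = 1` can be pushed outwards. -/
theorem OrliczClass.exists_lt_one_sum_le (hφ : OrliczClass φ)
    (hne : ∃ t ∈ Set.Icc (0 : ℝ) 1, φ t ≠ t) {x y : ℝ} (hx : 0 < x) (hy : 0 < y)
    (hxy : x + y = 1) : ∃ r : ℝ, 0 < r ∧ r < 1 ∧ φ (x / r) + φ (y / r) ≤ 1 := by
  have hm0 : 0 < max x y := lt_max_of_lt_left hx
  have hm1 : max x y < 1 := max_lt (by linarith) (by linarith)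
  -- On [0, t] the function lies below the line of slope φ t / t < 1. The dilation r must be at
  -- least this slope and must keep x / r, y / r within [0, t].
  obtain ⟨t, hmt, ht1⟩ := exists_between hm1
  have ht0 : 0 < t := hm0.trans hmt
  have hκ : φ t / t < 1 := (div_lt_one ht0).2 (hφ.lt_self hne ⟨ht0, ht1⟩)
  have hr0 : 0 < max (φ t / t) (max x y / t) := lt_max_of_lt_right (by positivity)
  refine ⟨max (φ t / t) (max x y / t), hr0, max_lt hκ ((div_lt_one ht0).2 hmt), ?_⟩
  set r := max (φ t / t) (max x y / t) with hr
  have key : ∀ z, 0 < z → z ≤ max x y → φ (z / r) ≤ z := by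
    intro z hz hzm
    have h1 : z / r ≤ t := by
      rw [div_le_iff₀ hr0, ← div_le_iff₀' ht0]
      exact (div_le_div_of_nonneg_right hzm ht0.le).trans (le_max_right _ _)
    have h2 := hφ.map_mul_le (a := z / r / t) (t := t) (by positivity)
      ((div_le_one ht0).2 h1) ht0.le
    rw [div_mul_cancel₀ _ ht0.ne'] at h2
    refine h2.trans ?_
    rw [div_mul_eq_mul_div, mul_div_assoc, div_mul_eq_mul_div, div_le_iff₀ hr0]
    gcongr
    exact le_max_left _ _
  linarith [key x hx (le_max_left _ _), key y hy (le_max_right _ _)]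

/-- Merging the two parallel vectors preserves the classical volume. In direction v, where Λ
contributes nothing, the Orlicz support strictly grows, so the merged zonotope has an extra cap. -/
theorem volumeDeficit_pos_of_parallel (hφ : OrliczClass φ)
    (hne : ∃ t ∈ Set.Icc (0 : ℝ) 1, φ t ≠ t) {v : EuclideanSpace ℝ (Fin n)} (hv : v ≠ 0)
    {α β : ℝ} (hα : 0 < α) (hβ : 0 < β) {Λ : Multiset (EuclideanSpace ℝ (Fin n))}
    (hΛv : ∀ w ∈ Λ, inner ℝ w v = 0)
    (hΛ : ∀ x, (∀ w ∈ Λ, inner ℝ w x = 0) → ∃ c : ℝ, x = c • v) :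
    0 < volumeDeficit φ (α • v ::ₘ β • v ::ₘ Λ) := by
  have hvv : 0 < inner ℝ v v := real_inner_self_pos.2 hv
  have hq : 0 < (α + β) * inner ℝ v v := mul_pos (add_pos hα hβ) hvv
  have hspan : IsSpanning ((α + β) • v ::ₘ Λ) := by
    refine isSpanning_iff.2 fun x hx => ?_
    obtain ⟨c, rfl⟩ := hΛ x fun w hw => hx w (Multiset.mem_cons_of_mem hw)
    have h := hx _ (Multiset.mem_cons_self _ _)
    rw [real_inner_smul_left, real_inner_smul_right, mul_left_comm] at h
    rw [(mul_eq_zero.1 h).resolve_right hq.ne', zero_smul]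
  have hsupp : orliczSupport φ (α • v ::ₘ β • v ::ₘ Λ) v < (α + β) * inner ℝ v v := by
    obtain ⟨r, hr0, hr1, hr⟩ := hφ.exists_lt_one_sum_le hne (x := α / (α + β))
      (y := β / (α + β)) (by positivity) (by positivity) (by field_simp)
    refine lt_of_le_of_lt (orliczSupport_le (r := r * ((α + β) * inner ℝ v v))
      (mul_pos hr0 hq) ?_) (mul_lt_of_lt_one_left hq hr1)
    have hz : (Λ.map fun w => φ (max 0 (inner ℝ w v) / (r * ((α + β) * inner ℝ v v)))).sum = 0 := by
      rw [Multiset.map_congr rfl (g := fun _ => (0 : ℝ)) fun w hw => by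
        rw [hΛv w hw, max_self, zero_div, hφ.zero]]
      simp
    rw [Multiset.map_cons, Multiset.sum_cons, Multiset.map_cons, Multiset.sum_cons, hz, add_zero,
      max_zero_inner_smul hα.le, max_zero_inner_smul hβ.le, max_eq_right hvv.le]
    convert hr using 3 <;> field_simp
  have hlt : volume (orliczZonotope φ (α • v ::ₘ β • v ::ₘ Λ)) <
      volume (orliczZonotope φ ((α + β) • v ::ₘ Λ)) := by
    refine volume_lt_of_halfspace
      (volume_orliczZonotope_ne_top φ _) (convex_orliczZonotope φ _)
      (interior_orliczZonotope_nonempty hφ hspan)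
      (fun x hx u => (hx u).trans (orliczSupport_merge_le hφ hα.le hβ.le v Λ u))
      (u := v) (p := (α + β) • v) (fun x hx => hx v)
      (subset_orliczZonotope hφ (Multiset.mem_cons_self _ _)) ?_
    rwa [real_inner_smul_left]
  have hlt' := ENNReal.toReal_strict_mono (volume_orliczZonotope_ne_top φ _) hlt
  have hnn := volumeDeficit_nonneg hφ ((α + β) • v ::ₘ Λ)
  rw [volumeDeficit, Measure.real, Measure.real] at hnn ⊢
  rw [zonotope_merge hα.le hβ.le]
  linarith

/-- Contract the members of J one by one into I. Since they are orthogonal to z, the inner products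
of u and v with z never change; once J is exhausted, u and v are positive multiples of z. -/
theorem volumeDeficit_pos_of_contraction (hφ : OrliczClass φ)
    (hne : ∃ t ∈ Set.Icc (0 : ℝ) 1, φ t ≠ t) {z : EuclideanSpace ℝ (Fin n)} (hz : z ≠ 0) (m : ℕ) :
    ∀ (I J : Multiset (EuclideanSpace ℝ (Fin n))) (u v : EuclideanSpace ℝ (Fin n)), J.card = m →
      (∀ t ∈ I, inner ℝ t z = 0) → (∀ t ∈ J, inner ℝ t z = 0) →
      0 < inner ℝ u z → 0 < inner ℝ v z →
      (∀ t ∈ I, inner ℝ t u = 0) → (∀ t ∈ I, inner ℝ t v = 0) →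
      (∀ t ∈ I, ∀ s ∈ J, inner ℝ t s = 0) →
      (∀ x, (∀ t ∈ I, inner ℝ t x = 0) → (∀ t ∈ J, inner ℝ t x = 0) → ∃ c : ℝ, x = c • z) →
      0 < volumeDeficit φ (u ::ₘ v ::ₘ (I + J)) := by
  induction m with
  | zero =>
    intro I J u v hJ hIz _ hu hv hIu hIv _ hspan
    obtain rfl := Multiset.card_eq_zero.1 hJ
    obtain ⟨α, rfl⟩ := hspan u hIu (by simp)
    obtain ⟨β, rfl⟩ := hspan v hIv (by simp)
    have hzz : 0 < inner ℝ z z := real_inner_self_pos.2 hz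
    rw [real_inner_smul_left] at hu hv
    rw [add_zero]
    exact volumeDeficit_pos_of_parallel hφ hne hz (pos_of_mul_pos_left hu hzz.le)
      (pos_of_mul_pos_left hv hzz.le) hIz fun x hx => hspan x hx (by simp)
  | succ m ih =>
    intro I J u v hJ hIz hJz hu hv hIu hIv hIJ hspan
    obtain ⟨w, hwJ⟩ := Multiset.card_pos_iff_exists_mem.1 (by omega : 0 < J.card)
    obtain ⟨J, rfl⟩ := Multiset.exists_cons_of_mem hwJ
    rw [Multiset.card_cons, add_left_inj] at hJ
    simp only [Multiset.mem_cons, forall_eq_or_imp] at hJz hIJ hspan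
    have hperm : u ::ₘ v ::ₘ (I + w ::ₘ J) = w ::ₘ u ::ₘ v ::ₘ (I + J) := by
      rw [Multiset.add_cons, Multiset.cons_swap v w, Multiset.cons_swap u w]
    rw [hperm]
    by_cases hw : w = 0
    · rw [hw, volumeDeficit_zero_cons hφ]
      exact ih I J u v hJ hIz hJz.2 hu hv hIu hIv (fun t ht => (hIJ t ht).2)
        fun x hxI hxJ => hspan x hxI ⟨by simp [hw], hxJ⟩
    refine lt_of_lt_of_le ?_ (volumeDeficit_map_le_cons hφ hw _)
    have hIw : I.map (hyperplaneProj w) = I := by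
      conv_rhs => rw [← Multiset.map_id I]
      refine Multiset.map_congr rfl fun t ht => hyperplaneProj_eq_self ?_
      rw [real_inner_comm, (hIJ t ht).1]
    have hPz (x) : inner ℝ (hyperplaneProj w x) z = inner ℝ x z := by
      rw [hyperplaneProj_apply, inner_sub_left, real_inner_smul_left, hJz.1, mul_zero, sub_zero]
    have hIP (t) (ht : t ∈ I) (x) : inner ℝ t (hyperplaneProj w x) = inner ℝ t x := by
      rw [hyperplaneProj_apply, inner_sub_right, real_inner_smul_right, (hIJ t ht).1, mul_zero,
        sub_zero]
    have hperm' : w ::ₘ (u ::ₘ v ::ₘ (I + J)).map (hyperplaneProj w) =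
        hyperplaneProj w u ::ₘ hyperplaneProj w v ::ₘ
          ((w ::ₘ I) + J.map (hyperplaneProj w)) := by
      rw [Multiset.map_cons, Multiset.map_cons, Multiset.map_add, hIw, Multiset.cons_add,
        Multiset.cons_swap _ w, Multiset.cons_swap _ w]
    rw [hperm']
    refine ih (w ::ₘ I) (J.map (hyperplaneProj w)) _ _ (by rwa [Multiset.card_map]) ?_ ?_
      (by rwa [hPz]) (by rwa [hPz]) ?_ ?_ ?_ ?_
    · exact Multiset.forall_mem_cons.2 ⟨hJz.1, hIz⟩
    · intro t ht
      obtain ⟨s, hs, rfl⟩ := Multiset.mem_map.1 ht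
      rw [hPz, hJz.2 s hs]
    · exact Multiset.forall_mem_cons.2 ⟨inner_hyperplaneProj hw u, fun t ht => by
        rw [hIP t ht, hIu t ht]⟩
    · exact Multiset.forall_mem_cons.2 ⟨inner_hyperplaneProj hw v, fun t ht => by
        rw [hIP t ht, hIv t ht]⟩
    · refine Multiset.forall_mem_cons.2 ⟨fun s hs => ?_, fun t ht s hs => ?_⟩
      all_goals obtain ⟨s, hs', rfl⟩ := Multiset.mem_map.1 hs
      · exact inner_hyperplaneProj hw s
      · rw [hIP t ht, (hIJ t ht).2 s hs']
    · intro x hxI hxJ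
      rw [Multiset.forall_mem_cons] at hxI
      refine hspan x hxI.2 ⟨hxI.1, fun t ht => ?_⟩
      rw [eq_smul_add_hyperplaneProj w t, inner_add_left, real_inner_smul_left, hxI.1,
        hxJ _ (Multiset.mem_map_of_mem _ ht), mul_zero, add_zero]

/-- The hyperplane `zᗮ` is spanned by the elements of `Λ` that it contains. -/
def SpansHyperplane (Λ : Multiset (EuclideanSpace ℝ (Fin n))) (z : EuclideanSpace ℝ (Fin n)) :
    Prop :=
  ∀ x, (∀ t ∈ Λ, inner ℝ t z = 0 → inner ℝ t x = 0) → ∃ c : ℝ, x = c • z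

theorem volumeDeficit_pos_of_spansHyperplane (hφ : OrliczClass φ)
    (hne : ∃ t ∈ Set.Icc (0 : ℝ) 1, φ t ≠ t) {Λ : Multiset (EuclideanSpace ℝ (Fin n))}
    {u v z : EuclideanSpace ℝ (Fin n)} (huv : u ::ₘ v ::ₘ 0 ≤ Λ) (hz : SpansHyperplane Λ z)
    (hu : 0 < inner ℝ u z) (hv : 0 < inner ℝ v z) : 0 < volumeDeficit φ Λ := by
  classical
  have hz0 : z ≠ 0 := by
    rintro rfl
    simp at hu
  obtain ⟨Γ, rfl⟩ := Multiset.le_iff_exists_add.1 huv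
  rw [Multiset.cons_add, Multiset.cons_add, zero_add] at hz ⊢
  have hpos := volumeDeficit_pos_of_contraction hφ hne hz0 _ 0
    -- Only u, v and the members in the hyperplane are kept; monotonicity of the deficit restores
    -- the rest.
    (Γ.filter fun t => inner ℝ t z = 0) u v rfl (by simp) (by simp) hu hv (by simp) (by simp)
    (by simp) fun x _ hx => hz x (by
      simp only [Multiset.mem_cons, forall_eq_or_imp]
      exact ⟨fun h => absurd h hu.ne', fun h => absurd h hv.ne',
        fun t ht htz => hx t (Multiset.mem_filter.2 ⟨ht, htz⟩)⟩)
  refine hpos.trans_le (volumeDeficit_mono hφ ?_)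
  rw [zero_add]
  exact Multiset.cons_le_cons _ (Multiset.cons_le_cons _ (Multiset.filter_le _ _))

end Strict

/-! ### The equality case -/

section Equality

variable {n : ℕ} {φ : ℝ → ℝ}

theorem SpansHyperplane.neg {Λ : Multiset (EuclideanSpace ℝ (Fin n))}
    {z : EuclideanSpace ℝ (Fin n)} (hz : SpansHyperplane Λ z) : SpansHyperplane Λ (-z) := by
  intro x hx
  obtain ⟨c, rfl⟩ := hz x fun t ht htz => hx t ht (by rw [inner_neg_right, htz, neg_zero])
  exact ⟨-c, by simp⟩

/-- Every vector is a combination of normals of hyperplanes that are spanned by elements of a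
spanning multiset. -/
theorem mem_span_spansHyperplane {Λ : Multiset (EuclideanSpace ℝ (Fin n))} (hΛ : IsSpanning Λ)
    (s : Finset (EuclideanSpace ℝ (Fin n))) :
    ∀ z, (∀ t ∈ Λ, inner ℝ t z ≠ 0 → t ∈ s) →
      z ∈ Submodule.span ℝ {x | SpansHyperplane Λ x} := by
  classical
  rw [isSpanning_iff] at hΛ
  induction s using Finset.strongInduction with
  | H s ih =>
    intro z hzs
    by_cases hz : SpansHyperplane Λ z
    · exact Submodule.subset_span hz
    simp only [SpansHyperplane, not_forall, not_exists] at hz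
    obtain ⟨x, hx, hxz⟩ := hz
    -- eliminating an element of `Λ` from `z` with the help of `y` shrinks the support
    have key (y t : EuclideanSpace ℝ (Fin n))
        (hy : ∀ t ∈ Λ, inner ℝ t z = 0 → inner ℝ t y = 0) (ht : t ∈ Λ) (hty : inner ℝ t y ≠ 0) :
        (∀ r ∈ Λ, inner ℝ r z = 0 → inner ℝ r (z - (inner ℝ t z / inner ℝ t y) • y) = 0) ∧
        z - (inner ℝ t z / inner ℝ t y) • y ∈ Submodule.span ℝ {x | SpansHyperplane Λ x} := by
      have hvan : ∀ r ∈ Λ, inner ℝ r z = 0 →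
          inner ℝ r (z - (inner ℝ t z / inner ℝ t y) • y) = 0 := fun r hr hrz => by
        rw [inner_sub_right, real_inner_smul_right, hrz, hy r hr hrz, mul_zero, sub_zero]
      refine ⟨hvan, ih (s.erase t) (Finset.erase_ssubset (hzs t ht (mt (hy t ht) hty))) _
        fun r hr hr0 => Finset.mem_erase.2 ⟨?_, hzs r hr (mt (hvan r hr) hr0)⟩⟩
      rintro rfl
      apply hr0
      rw [inner_sub_right, real_inner_smul_right, div_mul_cancel₀ _ hty, sub_self]
    have hx0 : x ≠ 0 := fun h => hxz 0 (by rw [h, zero_smul])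
    have ⟨t, ht, htx⟩ : ∃ t ∈ Λ, inner ℝ t x ≠ 0 := by
      by_contra! h
      exact hx0 (hΛ x h)
    obtain ⟨hy, hymem⟩ := key x t hx ht htx
    set y := z - (inner ℝ t z / inner ℝ t x) • x with hydef
    have hy0 : y ≠ 0 := by
      intro h
      have hc : inner ℝ t z / inner ℝ t x ≠ 0 := div_ne_zero (mt (hx t ht) htx) htx
      exact hxz _ ((eq_inv_smul_iff₀ hc).2 (sub_eq_zero.1 (hydef.symm.trans h)).symm)
    have ⟨r, hr, hry⟩ : ∃ r ∈ Λ, inner ℝ r y ≠ 0 := by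
      by_contra! h
      exact hy0 (hΛ y h)
    -- With c chosen to annihilate r, z = (z - c y) + c y, and both summands have smaller support
    -- than z.
    have := Submodule.add_mem _ (key y r hy hr hry).2
      (Submodule.smul_mem _ (inner ℝ r z / inner ℝ r y) hymem)
    rwa [sub_add_cancel] at this

theorem exists_basis_spansHyperplane {Λ : Multiset (EuclideanSpace ℝ (Fin n))}
    (hΛ : IsSpanning Λ) : ∃ f : Fin n → EuclideanSpace ℝ (Fin n),
      (∀ i, SpansHyperplane Λ (f i)) ∧ ∀ x, (∀ i, inner ℝ (f i) x = 0) → x = 0 := by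
  classical
  have htop : Submodule.span ℝ {x | SpansHyperplane Λ x} = ⊤ :=
    eq_top_iff.2 fun z _ => mem_span_spansHyperplane hΛ Λ.toFinset z fun t ht _ => by simpa using ht
  have hn : n = Module.finrank ℝ (Submodule.span ℝ {x | SpansHyperplane Λ x}) := by
    rw [htop, finrank_top, finrank_euclideanSpace_fin]
  obtain ⟨f, hf, hspan, -⟩ := Submodule.exists_fun_fin_finrank_span_eq ℝ {x | SpansHyperplane Λ x}
  refine ⟨fun i => f (Fin.cast hn i), fun i => hf _, fun x hx => ?_⟩
  have hs : IsSpanning (Finset.univ.val.map f) := by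
    refine (congrArg (Submodule.span ℝ) ?_).trans (hspan.trans htop)
    ext v
    simp
  refine isSpanning_iff.1 hs x fun w hw => ?_
  obtain ⟨j, -, rfl⟩ := Multiset.mem_map.1 hw
  simpa using hx (Fin.cast hn.symm j)

/-- Take as coordinates the inner products with n independent normals of spanned hyperplanes. By
`H`, applied to each normal and its negative, two members never have coordinates of equal strict
sign, so every term of their inner product is nonpositive. -/
theorem isGLImageOfObtuse_nonzeroPart {Λ : Multiset (EuclideanSpace ℝ (Fin n))}
    (hΛ : IsSpanning Λ)
    (H : ∀ u v z, u ::ₘ v ::ₘ 0 ≤ Λ → SpansHyperplane Λ z → 0 < inner ℝ u z → inner ℝ v z ≤ 0) :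
    IsGLImageOfObtuse (nonzeroPart Λ) := by
  classical
  obtain ⟨f, hf, hf0⟩ := exists_basis_spansHyperplane hΛ
  let L : EuclideanSpace ℝ (Fin n) →ₗ[ℝ] EuclideanSpace ℝ (Fin n) :=
    { toFun := fun x => WithLp.toLp 2 fun i => inner ℝ (f i) x
      map_add' := fun x y => by ext i; simp [inner_add_right]
      map_smul' := fun c x => by ext i; simp [real_inner_smul_right] }
  have hL : Function.Injective L := by
    rw [injective_iff_map_eq_zero]
    exact fun x hx => hf0 x fun i => congrArg (fun y : EuclideanSpace ℝ (Fin n) => y i) hx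
  have hLinner (u v) (huv : u ::ₘ v ::ₘ 0 ≤ Λ) : inner ℝ (L u) (L v) ≤ 0 := by
    simp only [PiLp.inner_apply, RCLike.inner_apply, conj_trivial]
    refine Finset.sum_nonpos fun i _ => ?_
    change inner ℝ (f i) v * inner ℝ (f i) u ≤ 0
    by_contra! hpos
    rw [real_inner_comm v, real_inner_comm u] at hpos
    rcases pos_and_pos_or_neg_and_neg_of_mul_pos hpos with h | h
    · exact (H u v (f i) huv (hf i) h.2).not_gt h.1
    · have := H u v (-f i) huv (hf i).neg (by rw [inner_neg_right]; linarith)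
      rw [inner_neg_right] at this
      linarith
  have hle : nonzeroPart Λ ≤ Λ := Multiset.filter_le _ _
  have hnodup : (nonzeroPart Λ).Nodup := by
    -- A repeated vector may be paired with itself, so its image has nonpositive squared norm.
    refine Multiset.nodup_iff_le.2 fun a ha => ?_
    have ha0 : a ≠ 0 := (Multiset.mem_filter.1
      (Multiset.mem_of_le ha (Multiset.mem_cons_self a _))).2
    exact ha0 (hL ((real_inner_self_nonpos.1 (hLinner a a (ha.trans hle))).trans L.map_zero.symm))
  refine ⟨⟨(nonzeroPart Λ).map L, hnodup.map hL⟩, (LinearEquiv.ofInjectiveEndo L hL).symm,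
    ?_, ?_⟩
  · intro u hu v hv huv
    obtain ⟨u, hu, rfl⟩ := Multiset.mem_map.1 hu
    obtain ⟨v, hv, rfl⟩ := Multiset.mem_map.1 hv
    refine max_eq_left (hLinner u v (le_trans ?_ hle))
    have huv' : u ≠ v := fun h => huv (by rw [h])
    refine (Multiset.le_iff_subset (by simpa using huv')).2 ?_
    intro x hx
    simp only [Multiset.mem_cons, Multiset.notMem_zero, or_false] at hx
    rcases hx with rfl | rfl <;> assumption
  · rw [Multiset.map_map]
    conv_lhs => rw [← Multiset.map_id (nonzeroPart Λ)]
    exact Multiset.map_congr rfl fun x _ =>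
      ((LinearEquiv.ofInjectiveEndo L hL).symm_apply_apply x).symm

theorem volumeDeficit_eq_zero_iff (hφ : OrliczClass φ)
    (hne : ∃ t ∈ Set.Icc (0 : ℝ) 1, φ t ≠ t) {Λ : Multiset (EuclideanSpace ℝ (Fin n))}
    (hΛ : IsSpanning Λ) : volumeDeficit φ Λ = 0 ↔ IsGLImageOfObtuse (nonzeroPart Λ) := by
  refine ⟨fun h => isGLImageOfObtuse_nonzeroPart hΛ fun u v z huv hz hu => ?_, fun h => ?_⟩
  · by_contra! hv
    exact (volumeDeficit_pos_of_spansHyperplane hφ hne huv hz hu hv).ne' h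
  · rw [← volumeDeficit_nonzeroPart hφ, volumeDeficit_of_isGLImageOfObtuse hφ h]

theorem volumeRatio_of_eq_id (hφ : OrliczClass φ) (hid : ∀ t ∈ Set.Icc (0 : ℝ) 1, φ t = t)
    {Λ : Multiset (EuclideanSpace ℝ (Fin n))} (hΛ : IsSpanning Λ) : volumeRatio φ Λ = 1 := by
  rw [volumeRatio, orliczZonotope_eq_of_eq_id hφ hid]
  exact div_self (volume_real_orliczZonotope_pos orliczClass_id hΛ).ne'

end Equality

/-! ### From deficits back to volume ratios -/

theorem theorem1p2 {n : ℕ} (φ : ℝ → ℝ) (hφ : OrliczClass φ)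
    (Λ : Multiset (EuclideanSpace ℝ (Fin n))) (hΛ : IsSpanning Λ) :
    volumeRatio φ Λ ≤ volumeRatio φ (canonicalBasis n) ∧
    ((∃ t ∈ Set.Icc (0 : ℝ) 1, φ t ≠ t) →
      (volumeRatio φ Λ = volumeRatio φ (canonicalBasis n) ↔
        IsGLImageOfObtuse (nonzeroPart Λ))) ∧
    ((∀ t ∈ Set.Icc (0 : ℝ) 1, φ t = t) →
      volumeRatio φ Λ = volumeRatio φ (canonicalBasis n)) := by
  have hpos := volume_real_orliczZonotope_pos orliczClass_id hΛ
  refine ⟨?_, fun hne => ?_, fun hid => ?_⟩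
  · have := volumeDeficit_nonneg hφ Λ
    rw [volumeDeficit, sub_nonneg] at this
    rwa [volumeRatio, div_le_iff₀ hpos]
  · rw [← volumeDeficit_eq_zero_iff hφ hne hΛ, volumeDeficit, sub_eq_zero, volumeRatio,
      div_eq_iff hpos.ne', eq_comm]
  · rw [volumeRatio_of_eq_id hφ hid hΛ,
      volumeRatio_of_eq_id hφ hid (isSpanning_canonicalBasis n)]
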